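/- For $n\ge 2$, a matrix $A\in\mathrm{SL}(n,\mathbb Z)$ is called a Cappell–Shaneson matrix of order $n$ if $\det(I-\bigwedge^kA)\in\{1,-1\}$ for every integer $k$ with $1\le k\le\lfloor n/2\rfloor$, where $\bigwedge^kA$ is the $k$-th exterior power of $A$. A monic polynomial $f\in\mathbb Z[x]$ of degree $n$ is called a Cappell–Shaneson polynomial if it is the characteristic polynomial $\det(xI-A)$ of a Cappell–Shaneson matrix $A$ of order $n$; it is called positive if moreover $(-1)^nf(t)>0$ for every real $t<0$. **Proposition 6.1.** Let $f(x)=x^6+c_5x^5+c_4x^4+c_3x^3+c_2x^2+c_1x+c_0$ be a monic polynomial of degree $6$ with integer coefficients such that $0\le c_5-c_1\le 12$. Then $f$ is a Cappell–Shaneson polynomial if and only if $(c_0,c_1,c_2,c_3,c_4,c_5)$ is one of the tuples listed below, where $a$ is an arbitrary integer. Further, for each listed tuple (and each $a$, in case of a family), the corresponding $f$ is positive if and only if the condition stated with that tuple holds ("Yes": $f$ is positive; "No": $f$ is not positive; "all $a$": $f$ is positive for every $a\in\mathbb Z$). $c_5-c_1=0$: - $(1,\ 2a+1,\ a^2-a,\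 -2a^2-2a-2,\ a^2-a-1,\ 2a+1)$: $a\le 0$ - $(1,\ 2a+1,\ a^2-a-1,\ -2a^2-2a-2,\ a^2-a-2,\ 2a+1)$: $a\le -1$ - $(1,\ 2a+1,\ a^2-a-1,\ -2a^2-2a-2,\ a^2-a,\ 2a+1)$: $a\le 0$ - $(1,\ 2a+1,\ a^2-a-2,\ -2a^2-2a-2,\ a^2-a-1,\ 2a+1)$: $a\le -1$ $c_5-c_1=1$: - $(1,\ 3a-1,\ 3a^2-a+4,\ -6a^2-4a-6,\ 3a^2-a+2,\ 3a)$: all $a$ - $(1,\ 3a,\ 3a^2+a+4,\ -6a^2-8a-8,\ 3a^2+a+2,\ 3a+1)$: all $a$ - $(1,\ 2a-1,\ a^2-3a,\ -2a^2+a-1,\ a^2-2a+1,\ 2a)$: $a\le 0$ - $(1,\ 2a,\ a^2-2a-1,\ -2a^2-a-1,\ a^2-a,\ 2a+1)$: $a\le 0$ - $(1,\ -5,\ 10,\ -11,\ 7,\ -4)$: Yes - $(1,\ -12,\ 45,\ -67,\ 42,\ -11)$: Yes - $(1,\ -2,\ 3,\ -3,\ 2,\ -1)$: Yes - $(1,\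 -7,\ 18,\ -23,\ 17,\ -6)$: Yes - $(1,\ 5a-2,\ 5a^2-11a+2,\ -10a^2+12a-2,\ 5a^2-11a,\ 5a-1)$: $a\le 0$ - $(1,\ 5a-1,\ 5a^2-9a,\ -10a^2+8a,\ 5a^2-9a-2,\ 5a)$: $a\le 0$ - $(1,\ 5a,\ 5a^2-7a-2,\ -10a^2+4a+2,\ 5a^2-7a-4,\ 5a+1)$: $a\le -1$ - $(1,\ 5a+2,\ 5a^2-3a-4,\ -10a^2-4a+2,\ 5a^2-3a-6,\ 5a+3)$: $a\le -1$ - $(1,\ 2a-1,\ a^2-3a,\ -2a^2+a-2,\ a^2-2a,\ 2a)$: $a\le 0$ - $(1,\ 2a,\ a^2-2a-1,\ -2a^2-a-3,\ a^2-a,\ 2a+1)$: $a\le 2$ - $(1,\ 2a-1,\ a^2-3a,\ -2a^2+a-3,\ a^2-2a+1,\ 2a)$: $a\le 3$ - $(1,\ 2a,\ a^2-2a-2,\ -2a^2-a-2,\ a^2-a,\ 2a+1)$: $a\le 0$ $c_5-c_1=2$: - $(1,\ -5,\ 11,\ -12,\ 8,\ -3)$: Yes - $(1,\ -7,\ 18,\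 -22,\ 15,\ -5)$: Yes - $(1,\ -13,\ 53,\ -72,\ 42,\ -11)$: Yes - $(1,\ -15,\ 68,\ -98,\ 57,\ -13)$: Yes - $(1,\ 1,\ -4,\ -4,\ 1,\ 3)$: No - $(1,\ 3,\ -3,\ -10,\ 2,\ 5)$: No - $(1,\ -7,\ 17,\ -18,\ 10,\ -5)$: Yes - $(1,\ -13,\ 50,\ -72,\ 43,\ -11)$: Yes - $(1,\ -3,\ 4,\ -4,\ 3,\ -1)$: Yes - $(1,\ -5,\ 9,\ -10,\ 8,\ -3)$: Yes - $(1,\ -7,\ 15,\ -14,\ 10,\ -5)$: Yes - $(1,\ -9,\ 24,\ -28,\ 19,\ -7)$: Yes - $(1,\ -15,\ 69,\ -98,\ 56,\ -13)$: Yes - $(1,\ -17,\ 86,\ -128,\ 73,\ -15)$: Yes - $(1,\ 1,\ -3,\ -4,\ 0,\ 3)$: No - $(1,\ -1,\ -2,\ -2,\ 1,\ 1)$: Yes $c_5-c_1=3$: - $(1,\ -12,\ 35,\ -43,\ 28,\ -9)$: Yes - $(1,\ -15,\ 68,\ -91,\ 49,\ -12)$: Yes - $(1,\ -18,\ 93,\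 -135,\ 74,\ -15)$: Yes - $(1,\ 3,\ -4,\ -12,\ 4,\ 6)$: No - $(1,\ -9,\ 26,\ -27,\ 13,\ -6)$: Yes - $(1,\ -15,\ 64,\ -91,\ 51,\ -12)$: Yes - $(1,\ -3,\ 2,\ -3,\ 3,\ 0)$: Yes - $(1,\ -6,\ 10,\ -4,\ 2,\ -3)$: Yes - $(1,\ -12,\ 38,\ -48,\ 30,\ -9)$: Yes - $(1,\ -15,\ 68,\ -90,\ 48,\ -12)$: Yes - $(1,\ -18,\ 94,\ -136,\ 74,\ -15)$: Yes - $(1,\ 0,\ -5,\ -3,\ 2,\ 3)$: No $c_5-c_1=4$: - $(1,\ -21,\ 122,\ -178,\ 93,\ -17)$: Yes - $(1,\ -11,\ 37,\ -38,\ 16,\ -7)$: Yes - $(1,\ -1,\ -3,\ -2,\ 2,\ 3)$: Yes - $(1,\ 1,\ -8,\ -6,\ 5,\ 5)$: No $c_5-c_1=5$: - $(1,\ -24,\ 155,\ -227,\ 114,\ -19)$: Yes - $(1,\ -13,\ 50,\ -51,\ 19,\ -8)$: Yes - $(1,\ 1,\ -6,\ -7,\ 5,\ 6)$: No - $(1,\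 2,\ -11,\ -11,\ 10,\ 7)$: No $c_5-c_1=6$: - $(1,\ -27,\ 192,\ -282,\ 137,\ -21)$: Yes - $(1,\ -15,\ 65,\ -66,\ 22,\ -9)$: Yes - $(1,\ -3,\ -5,\ 24,\ -22,\ 3)$: No - $(1,\ 3,\ -7,\ -18,\ 12,\ 9)$: No - $(1,\ 3,\ -14,\ -18,\ 17,\ 9)$: No $c_5-c_1=7$: - $(1,\ -30,\ 233,\ -343,\ 162,\ -23)$: Yes - $(1,\ -17,\ 82,\ -83,\ 25,\ -10)$: Yes - $(1,\ 5,\ -6,\ -35,\ 23,\ 12)$: No - $(1,\ 4,\ -17,\ -27,\ 26,\ 11)$: No - $(1,\ -21,\ 78,\ -106,\ 60,\ -14)$: Yes - $(1,\ -30,\ 248,\ -346,\ 148,\ -23)$: Yes - $(1,\ 18,\ 56,\ -228,\ 128,\ 25)$: No - $(1,\ -22,\ 81,\ -111,\ 64,\ -15)$: Yes $c_5-c_1=8$: - $(1,\ -33,\ 278,\ -410,\ 189,\ -25)$: Yes - $(1,\ -19,\ 101,\ -102,\ 28,\ -11)$: Yes - $(1,\ 7,\ -3,\ -58,\ 38,\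 15)$: No - $(1,\ 5,\ -20,\ -38,\ 37,\ 13)$: No $c_5-c_1=9$: - $(1,\ -36,\ 327,\ -483,\ 218,\ -27)$: Yes - $(1,\ -21,\ 122,\ -123,\ 31,\ -12)$: Yes - $(1,\ 9,\ 2,\ -87,\ 57,\ 18)$: No - $(1,\ 6,\ -23,\ -51,\ 50,\ 15)$: No - $(1,\ 34,\ 246,\ -734,\ 410,\ 43)$: No - $(1,\ 1,\ -28,\ 67,\ -51,\ 10)$: No - $(1,\ -31,\ 116,\ -162,\ 96,\ -22)$: Yes - $(1,\ -46,\ 566,\ -852,\ 366,\ -37)$: Yes $c_5-c_1=10$: - $(1,\ -39,\ 380,\ -562,\ 249,\ -29)$: Yes - $(1,\ -23,\ 145,\ -146,\ 34,\ -13)$: Yes - $(1,\ 11,\ 9,\ -122,\ 80,\ 21)$: No - $(1,\ 7,\ -26,\ -66,\ 65,\ 17)$: No $c_5-c_1=11$: - $(1,\ -42,\ 437,\ -647,\ 282,\ -31)$: Yes - $(1,\ -25,\ 170,\ -171,\ 37,\ -14)$: Yes - $(1,\ 13,\ 18,\ -163,\ 107,\ 24)$: No - $(1,\ 8,\ -29,\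 -83,\ 82,\ 19)$: No $c_5-c_1=12$: - $(1,\ -45,\ 498,\ -738,\ 317,\ -33)$: Yes - $(1,\ -27,\ 197,\ -198,\ 40,\ -15)$: Yes - $(1,\ 15,\ 29,\ -210,\ 138,\ 27)$: No - $(1,\ 9,\ -32,\ -102,\ 101,\ 21)$: No -/

import Mathlib

open Polynomial

namespace CappellShaneson

/-- The `k`-th exterior power `⋀ᵏA` of an integer square matrix `A`: the matrix of the endomorphism
of `⋀ᵏ(ℤⁿ)` induced by `A`, in the basis of `k`-fold wedge products of standard basis vectors. -/
noncomputable def extPow {n : ℕ} (k : ℕ) (A : Matrix (Fin n) (Fin n) ℤ) :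
    Matrix (Set.powersetCard (Fin n) k) (Set.powersetCard (Fin n) k) ℤ :=
  LinearMap.toMatrix ((Pi.basisFun ℤ (Fin n)).exteriorPower k)
    ((Pi.basisFun ℤ (Fin n)).exteriorPower k) (exteriorPower.map k (Matrix.toLin' A))

/-- The condition `CS_k`: `det (I - ⋀ᵏA) = ±1`. -/
def CSCond {n : ℕ} (k : ℕ) (A : Matrix (Fin n) (Fin n) ℤ) : Prop :=
  (1 - extPow k A).det = 1 ∨ (1 - extPow k A).det = -1

/-- `A ∈ SL(n, ℤ)` is a Cappell-Shaneson matrix of order `n` if it satisfies `CS_k` for every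
`k ∈ {1, …, ⌊n/2⌋}`. -/
def IsCSMatrix {n : ℕ} (A : Matrix.SpecialLinearGroup (Fin n) ℤ) : Prop :=
  ∀ k : ℕ, 1 ≤ k → k ≤ n / 2 → CSCond k (A : Matrix (Fin n) (Fin n) ℤ)

/-- A Cappell-Shaneson polynomial of degree `n`: the characteristic polynomial `det (xI - A)` of
a Cappell-Shaneson matrix `A` of order `n`. -/
def IsCSPolynomial (n : ℕ) (f : ℤ[X]) : Prop :=
  ∃ A : Matrix.SpecialLinearGroup (Fin n) ℤ,
    IsCSMatrix A ∧ (A : Matrix (Fin n) (Fin n) ℤ).charpoly = f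

/-- A Cappell-Shaneson polynomial `f` of degree `n` is positive if `(-1)ⁿ f(t) > 0` for every
real `t < 0`. -/
def IsPositiveCSPolynomial (n : ℕ) (f : ℤ[X]) : Prop :=
  IsCSPolynomial n f ∧ ∀ t : ℝ, t < 0 → 0 < (-1 : ℝ) ^ n * aeval t f

/-- A row of the table: for each value of the integer parameter `a`, the tuple
`(c₀, c₁, c₂, c₃, c₄, c₅)` and the positivity condition. Rows of a single polynomial do not
depend on `a`. -/
structure Row where
  /-- the coefficients `(c₀, c₁, c₂, c₃, c₄, c₅)` for the parameter value `a` -/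
  coeffs : ℤ → Fin 6 → ℤ
  /-- the condition on `a` for positivity -/
  pos : ℤ → Prop

/-- The table of Cappell-Shaneson polynomials of degree `6` with `0 ≤ c₅ - c₁ ≤ 12`. -/
def table : List Row := [
  -- coefficient difference c₅ - c₁ = 0
  ⟨fun a => ![1, 2 * a + 1, a ^ 2 - a, -2 * a ^ 2 - 2 * a - 2, a ^ 2 - a - 1, 2 * a + 1], fun a => a ≤ 0⟩,
  ⟨fun a => ![1, 2 * a + 1, a ^ 2 - a - 1, -2 * a ^ 2 - 2 * a - 2, a ^ 2 - a - 2, 2 * a + 1], fun a => a ≤ -1⟩,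
  ⟨fun a => ![1, 2 * a + 1, a ^ 2 - a - 1, -2 * a ^ 2 - 2 * a - 2, a ^ 2 - a, 2 * a + 1], fun a => a ≤ 0⟩,
  ⟨fun a => ![1, 2 * a + 1, a ^ 2 - a - 2, -2 * a ^ 2 - 2 * a - 2, a ^ 2 - a - 1, 2 * a + 1], fun a => a ≤ -1⟩,
  -- coefficient difference c₅ - c₁ = 1
  ⟨fun a => ![1, 3 * a - 1, 3 * a ^ 2 - a + 4, -6 * a ^ 2 - 4 * a - 6, 3 * a ^ 2 - a + 2, 3 * a], fun _ => True⟩,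
  ⟨fun a => ![1, 3 * a, 3 * a ^ 2 + a + 4, -6 * a ^ 2 - 8 * a - 8, 3 * a ^ 2 + a + 2, 3 * a + 1], fun _ => True⟩,
  ⟨fun a => ![1, 2 * a - 1, a ^ 2 - 3 * a, -2 * a ^ 2 + a - 1, a ^ 2 - 2 * a + 1, 2 * a], fun a => a ≤ 0⟩,
  ⟨fun a => ![1, 2 * a, a ^ 2 - 2 * a - 1, -2 * a ^ 2 - a - 1, a ^ 2 - a, 2 * a + 1], fun a => a ≤ 0⟩,
  ⟨fun _ => ![1, -5, 10, -11, 7, -4], fun _ => True⟩,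
  ⟨fun _ => ![1, -12, 45, -67, 42, -11], fun _ => True⟩,
  ⟨fun _ => ![1, -2, 3, -3, 2, -1], fun _ => True⟩,
  ⟨fun _ => ![1, -7, 18, -23, 17, -6], fun _ => True⟩,
  ⟨fun a => ![1, 5 * a - 2, 5 * a ^ 2 - 11 * a + 2, -10 * a ^ 2 + 12 * a - 2, 5 * a ^ 2 - 11 * a, 5 * a - 1], fun a => a ≤ 0⟩,
  ⟨fun a => ![1, 5 * a - 1, 5 * a ^ 2 - 9 * a, -10 * a ^ 2 + 8 * a, 5 * a ^ 2 - 9 * a - 2, 5 * a], fun a => a ≤ 0⟩,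
  ⟨fun a => ![1, 5 * a, 5 * a ^ 2 - 7 * a - 2, -10 * a ^ 2 + 4 * a + 2, 5 * a ^ 2 - 7 * a - 4, 5 * a + 1], fun a => a ≤ -1⟩,
  ⟨fun a => ![1, 5 * a + 2, 5 * a ^ 2 - 3 * a - 4, -10 * a ^ 2 - 4 * a + 2, 5 * a ^ 2 - 3 * a - 6, 5 * a + 3], fun a => a ≤ -1⟩,
  ⟨fun a => ![1, 2 * a - 1, a ^ 2 - 3 * a, -2 * a ^ 2 + a - 2, a ^ 2 - 2 * a, 2 * a], fun a => a ≤ 0⟩,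
  ⟨fun a => ![1, 2 * a, a ^ 2 - 2 * a - 1, -2 * a ^ 2 - a - 3, a ^ 2 - a, 2 * a + 1], fun a => a ≤ 2⟩,
  ⟨fun a => ![1, 2 * a - 1, a ^ 2 - 3 * a, -2 * a ^ 2 + a - 3, a ^ 2 - 2 * a + 1, 2 * a], fun a => a ≤ 3⟩,
  ⟨fun a => ![1, 2 * a, a ^ 2 - 2 * a - 2, -2 * a ^ 2 - a - 2, a ^ 2 - a, 2 * a + 1], fun a => a ≤ 0⟩,
  -- coefficient difference c₅ - c₁ = 2
  ⟨fun _ => ![1, -5, 11, -12, 8, -3], fun _ => True⟩,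
  ⟨fun _ => ![1, -7, 18, -22, 15, -5], fun _ => True⟩,
  ⟨fun _ => ![1, -13, 53, -72, 42, -11], fun _ => True⟩,
  ⟨fun _ => ![1, -15, 68, -98, 57, -13], fun _ => True⟩,
  ⟨fun _ => ![1, 1, -4, -4, 1, 3], fun _ => False⟩,
  ⟨fun _ => ![1, 3, -3, -10, 2, 5], fun _ => False⟩,
  ⟨fun _ => ![1, -7, 17, -18, 10, -5], fun _ => True⟩,
  ⟨fun _ => ![1, -13, 50, -72, 43, -11], fun _ => True⟩,
  ⟨fun _ => ![1, -3, 4, -4, 3, -1], fun _ => True⟩,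
  ⟨fun _ => ![1, -5, 9, -10, 8, -3], fun _ => True⟩,
  ⟨fun _ => ![1, -7, 15, -14, 10, -5], fun _ => True⟩,
  ⟨fun _ => ![1, -9, 24, -28, 19, -7], fun _ => True⟩,
  ⟨fun _ => ![1, -15, 69, -98, 56, -13], fun _ => True⟩,
  ⟨fun _ => ![1, -17, 86, -128, 73, -15], fun _ => True⟩,
  ⟨fun _ => ![1, 1, -3, -4, 0, 3], fun _ => False⟩,
  ⟨fun _ => ![1, -1, -2, -2, 1, 1], fun _ => True⟩,
  -- coefficient difference c₅ - c₁ = 3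
  ⟨fun _ => ![1, -12, 35, -43, 28, -9], fun _ => True⟩,
  ⟨fun _ => ![1, -15, 68, -91, 49, -12], fun _ => True⟩,
  ⟨fun _ => ![1, -18, 93, -135, 74, -15], fun _ => True⟩,
  ⟨fun _ => ![1, 3, -4, -12, 4, 6], fun _ => False⟩,
  ⟨fun _ => ![1, -9, 26, -27, 13, -6], fun _ => True⟩,
  ⟨fun _ => ![1, -15, 64, -91, 51, -12], fun _ => True⟩,
  ⟨fun _ => ![1, -3, 2, -3, 3, 0], fun _ => True⟩,
  ⟨fun _ => ![1, -6, 10, -4, 2, -3], fun _ => True⟩,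
  ⟨fun _ => ![1, -12, 38, -48, 30, -9], fun _ => True⟩,
  ⟨fun _ => ![1, -15, 68, -90, 48, -12], fun _ => True⟩,
  ⟨fun _ => ![1, -18, 94, -136, 74, -15], fun _ => True⟩,
  ⟨fun _ => ![1, 0, -5, -3, 2, 3], fun _ => False⟩,
  -- coefficient difference c₅ - c₁ = 4
  ⟨fun _ => ![1, -21, 122, -178, 93, -17], fun _ => True⟩,
  ⟨fun _ => ![1, -11, 37, -38, 16, -7], fun _ => True⟩,
  ⟨fun _ => ![1, -1, -3, -2, 2, 3], fun _ => True⟩,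
  ⟨fun _ => ![1, 1, -8, -6, 5, 5], fun _ => False⟩,
  -- coefficient difference c₅ - c₁ = 5
  ⟨fun _ => ![1, -24, 155, -227, 114, -19], fun _ => True⟩,
  ⟨fun _ => ![1, -13, 50, -51, 19, -8], fun _ => True⟩,
  ⟨fun _ => ![1, 1, -6, -7, 5, 6], fun _ => False⟩,
  ⟨fun _ => ![1, 2, -11, -11, 10, 7], fun _ => False⟩,
  -- coefficient difference c₅ - c₁ = 6
  ⟨fun _ => ![1, -27, 192, -282, 137, -21], fun _ => True⟩,
  ⟨fun _ => ![1, -15, 65, -66, 22, -9], fun _ => True⟩,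
  ⟨fun _ => ![1, -3, -5, 24, -22, 3], fun _ => False⟩,
  ⟨fun _ => ![1, 3, -7, -18, 12, 9], fun _ => False⟩,
  ⟨fun _ => ![1, 3, -14, -18, 17, 9], fun _ => False⟩,
  -- coefficient difference c₅ - c₁ = 7
  ⟨fun _ => ![1, -30, 233, -343, 162, -23], fun _ => True⟩,
  ⟨fun _ => ![1, -17, 82, -83, 25, -10], fun _ => True⟩,
  ⟨fun _ => ![1, 5, -6, -35, 23, 12], fun _ => False⟩,
  ⟨fun _ => ![1, 4, -17, -27, 26, 11], fun _ => False⟩,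
  ⟨fun _ => ![1, -21, 78, -106, 60, -14], fun _ => True⟩,
  ⟨fun _ => ![1, -30, 248, -346, 148, -23], fun _ => True⟩,
  ⟨fun _ => ![1, 18, 56, -228, 128, 25], fun _ => False⟩,
  ⟨fun _ => ![1, -22, 81, -111, 64, -15], fun _ => True⟩,
  -- coefficient difference c₅ - c₁ = 8
  ⟨fun _ => ![1, -33, 278, -410, 189, -25], fun _ => True⟩,
  ⟨fun _ => ![1, -19, 101, -102, 28, -11], fun _ => True⟩,
  ⟨fun _ => ![1, 7, -3, -58, 38, 15], fun _ => False⟩,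
  ⟨fun _ => ![1, 5, -20, -38, 37, 13], fun _ => False⟩,
  -- coefficient difference c₅ - c₁ = 9
  ⟨fun _ => ![1, -36, 327, -483, 218, -27], fun _ => True⟩,
  ⟨fun _ => ![1, -21, 122, -123, 31, -12], fun _ => True⟩,
  ⟨fun _ => ![1, 9, 2, -87, 57, 18], fun _ => False⟩,
  ⟨fun _ => ![1, 6, -23, -51, 50, 15], fun _ => False⟩,
  ⟨fun _ => ![1, 34, 246, -734, 410, 43], fun _ => False⟩,
  ⟨fun _ => ![1, 1, -28, 67, -51, 10], fun _ => False⟩,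
  ⟨fun _ => ![1, -31, 116, -162, 96, -22], fun _ => True⟩,
  ⟨fun _ => ![1, -46, 566, -852, 366, -37], fun _ => True⟩,
  -- coefficient difference c₅ - c₁ = 10
  ⟨fun _ => ![1, -39, 380, -562, 249, -29], fun _ => True⟩,
  ⟨fun _ => ![1, -23, 145, -146, 34, -13], fun _ => True⟩,
  ⟨fun _ => ![1, 11, 9, -122, 80, 21], fun _ => False⟩,
  ⟨fun _ => ![1, 7, -26, -66, 65, 17], fun _ => False⟩,
  -- coefficient difference c₅ - c₁ = 11
  ⟨fun _ => ![1, -42, 437, -647, 282, -31], fun _ => True⟩,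
  ⟨fun _ => ![1, -25, 170, -171, 37, -14], fun _ => True⟩,
  ⟨fun _ => ![1, 13, 18, -163, 107, 24], fun _ => False⟩,
  ⟨fun _ => ![1, 8, -29, -83, 82, 19], fun _ => False⟩,
  -- coefficient difference c₅ - c₁ = 12
  ⟨fun _ => ![1, -45, 498, -738, 317, -33], fun _ => True⟩,
  ⟨fun _ => ![1, -27, 197, -198, 40, -15], fun _ => True⟩,
  ⟨fun _ => ![1, 15, 29, -210, 138, 27], fun _ => False⟩,
  ⟨fun _ => ![1, 9, -32, -102, 101, 21], fun _ => False⟩]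

end CappellShaneson

/-!
Over `ℂ` an integer matrix `A` can be triangularized, and then the matrix of `⋀ᵏA`, whose entries are the
minors of `A`, is triangular as well. Hence `det (I - ⋀ᵏA) = ∏ (1 - ∏_{i ∈ S} λᵢ)`, over the `k`-subsets
`S` of the eigenvalues (`exists_eigenvalues`). If `n = 6` and `det A = 1`, explicit symmetric function
identities, obtained by adjoining one root at a time, give (`det_one_sub_extPow`):

* `det (I - A) = f(1)`;
* `det (I - ⋀²A)` is `pairInvariant`, which is linear in `c₁`, `c₂`, `c₃` once the differences
  `q = c₅ - c₁` and `p = c₄ - c₂` are fixed;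
* `det (I - ⋀³A)` is the square of `tripleInvariant`: complementary triples of eigenvalues have inverse
  products, so the factors come in ten pairs.

As every monic polynomial is a characteristic polynomial, `f` is a Cappell-Shaneson polynomial if and
only if `c₀ = 1` and the three integers `u = f(1)`, `v` and `w` (the two invariants) are `±1`
(`isCSPolynomial_iff`).

Eliminating `c₃` by means of `u`, the pair condition becomes
`(p + 2q)(q(c₁(p - 2q) - c₂q) - q³ - (p - q)²) = v - uq³`. If `q > 0` and `v ≠ uq³`, then `p + 2q` is one
of the finitely many divisors of a nonzero integer; for each of them `c₁` and `c₂` satisfy a linear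
equation, and the triple condition turns into a quadratic equation in `c₁` alone. The resulting finite
list of quadratic equations is solved by a verified computation (`sporadicCheck`). The exceptions `q = 0`,
where `p = ±1`, and `q = 1`, `u = v` lead to conics, whose integral points are the families of the table.

Positivity is treated row by row, through certificates of positivity for `f(-s)` on `s > 0`, or
through a point at which `f` is not positive.
-/

namespace CappellShaneson

/-! ### Eigenvalues and exterior powers -/

theorem toMatrix_id_sub {R M ι : Type*} [CommRing R] [AddCommGroup M] [Module R M] [Fintype ι]
    [DecidableEq ι] (b : Module.Basis ι R M) (h : M →ₗ[R] M) :
    LinearMap.toMatrix b b (LinearMap.id - h) = 1 - LinearMap.toMatrix b b h := by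
  rw [map_sub, LinearMap.toMatrix_id]

/-- The matrix entries of an exterior power of `g` are the minors of the matrix of `g`. -/
theorem toMatrix_exteriorPower_map_apply {R M I : Type*} [CommRing R] [AddCommGroup M] [Module R M]
    [LinearOrder I] [Fintype I] (b : Module.Basis I R M) (g : M →ₗ[R] M) (k : ℕ)
    (S T : Set.powersetCard I k) :
    LinearMap.toMatrix (b.exteriorPower k) (b.exteriorPower k) (exteriorPower.map k g) S T =
      ((LinearMap.toMatrix b b g).submatrix (Set.powersetCard.ofFinEmbEquiv.symm S)
        (Set.powersetCard.ofFinEmbEquiv.symm T)).det := by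
  rw [LinearMap.toMatrix_apply, exteriorPower.basis_apply, exteriorPower.map_apply_ιMulti_family,
    exteriorPower.basis_repr_apply, exteriorPower.ιMulti_family,
    exteriorPower.ιMultiDual_apply_ιMulti, ← Matrix.det_transpose]
  congr 1
  ext i j
  simp [LinearMap.toMatrix_apply]

theorem sum_ofFinEmbEquiv_symm {I N : Type*} [LinearOrder I] [AddCommMonoid N] {k : ℕ}
    (S : Set.powersetCard I k) (w : I → N) :
    ∑ i, w (Set.powersetCard.ofFinEmbEquiv.symm S i) = ∑ i ∈ (S : Finset I), w i := by
  have : (S : Finset I) =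
      Finset.univ.map (Set.powersetCard.ofFinEmbEquiv.symm S).toEmbedding := by
    ext i
    rw [Set.powersetCard.mem_coe_iff, ← Set.powersetCard.mem_range_ofFinEmbEquiv_symm_iff_mem S i]
    simp
  rw [this, Finset.sum_map]
  rfl

theorem prod_ofFinEmbEquiv_symm {I N : Type*} [LinearOrder I] [CommMonoid N] {k : ℕ}
    (S : Set.powersetCard I k) (w : I → N) :
    ∏ i, w (Set.powersetCard.ofFinEmbEquiv.symm S i) = ∏ i ∈ (S : Finset I), w i :=
  sum_ofFinEmbEquiv_symm (N := Additive N) S w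

/-- A nonzero minor of an upper triangular matrix with rows `S` and columns `T` requires a bijection
`S → T` that does not decrease indices, so the index sums satisfy `∑ S ≤ ∑ T`, with equality only
for `S = T`. -/
theorem det_minor_eq_zero {R : Type*} [CommRing R] {n : ℕ} {A : Matrix (Fin n) (Fin n) R}
    (hA : A.IsUpperTriangular) {k : ℕ} {S T : Set.powersetCard (Fin n) k}
    (hST : ∑ i ∈ (T : Finset (Fin n)), (i : ℕ) ≤ ∑ i ∈ (S : Finset (Fin n)), (i : ℕ))
    (hne : S ≠ T) :
    (A.submatrix (Set.powersetCard.ofFinEmbEquiv.symm S)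
      (Set.powersetCard.ofFinEmbEquiv.symm T)).det = 0 := by
  rw [Matrix.det_apply]
  refine Finset.sum_eq_zero fun σ _ => ?_
  set s := Set.powersetCard.ofFinEmbEquiv.symm S with hs
  set t := Set.powersetCard.ofFinEmbEquiv.symm T with ht
  suffices h : ∃ i, t i < s (σ i) by
    obtain ⟨i, hi⟩ := h
    rw [Finset.prod_eq_zero (Finset.mem_univ i) (hA hi), smul_zero]
  by_contra! hle
  have h1 : ∑ i, (s (σ i) : ℕ) = ∑ i ∈ (S : Finset (Fin n)), (i : ℕ) :=
    (Equiv.sum_comp σ fun i => (s i : ℕ)).trans (sum_ofFinEmbEquiv_symm S fun i => (i : ℕ))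
  have h2 : ∑ i, (t i : ℕ) = ∑ i ∈ (T : Finset (Fin n)), (i : ℕ) :=
    sum_ofFinEmbEquiv_symm T fun i => (i : ℕ)
  have h3 : ∀ i ∈ Finset.univ, (s (σ i) : ℕ) = t i :=
    (Finset.sum_eq_sum_iff_of_le fun i _ => Fin.le_def.1 (hle i)).1
      (le_antisymm (Finset.sum_le_sum fun i _ => Fin.le_def.1 (hle i)) (by rw [h1, h2]; exact hST))
  apply hne
  rw [eq_comm, Set.powersetCard.eq_iff_subset]
  intro x hx
  obtain ⟨i, rfl⟩ := (Set.powersetCard.mem_range_ofFinEmbEquiv_symm_iff_mem T x).2 hx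
  rw [← ht, ← Fin.ext (h3 i (Finset.mem_univ i))]
  exact (Set.powersetCard.mem_range_ofFinEmbEquiv_symm_iff_mem S _).1 ⟨σ i, rfl⟩

theorem det_minor_self {R : Type*} [CommRing R] {n : ℕ} {A : Matrix (Fin n) (Fin n) R}
    (hA : A.IsUpperTriangular) {k : ℕ} (S : Set.powersetCard (Fin n) k) :
    (A.submatrix (Set.powersetCard.ofFinEmbEquiv.symm S)
      (Set.powersetCard.ofFinEmbEquiv.symm S)).det = ∏ i ∈ (S : Finset (Fin n)), A i i := by
  rw [Matrix.det_of_isUpperTriangular, ← prod_ofFinEmbEquiv_symm S fun i => A i i]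
  · rfl
  · intro i j hij
    exact hA ((Set.powersetCard.ofFinEmbEquiv.symm S).strictMono hij)

/-- Ordered by index sums, the matrix of `⋀ᵏg` is block triangular, and its diagonal blocks are diagonal
matrices, so `det (1 - ⋀ᵏg)` is read off from the diagonal of the matrix of `g`. -/
theorem det_one_sub_exteriorPower_map {K V : Type*} [Field K] [AddCommGroup V] [Module K V] {n : ℕ}
    (b : Module.Basis (Fin n) K V) (g : V →ₗ[K] V)
    (hg : (LinearMap.toMatrix b b g).IsUpperTriangular) (k : ℕ) :
    LinearMap.det (LinearMap.id - exteriorPower.map k g) =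
      ∏ S ∈ Finset.powersetCard k Finset.univ, (1 - ∏ i ∈ S, LinearMap.toMatrix b b g i i) := by
  set A := LinearMap.toMatrix b b g
  set M := LinearMap.toMatrix (b.exteriorPower k) (b.exteriorPower k) (LinearMap.id - exteriorPower.map k g)
    with hM
  have hentry : M = 1 - Matrix.of fun S T => (A.submatrix
      (Set.powersetCard.ofFinEmbEquiv.symm S) (Set.powersetCard.ofFinEmbEquiv.symm T)).det := by
    rw [hM, toMatrix_id_sub]
    congr 1
    ext S T
    exact toMatrix_exteriorPower_map_apply b g k S T
  let w : Set.powersetCard (Fin n) k → ℕ := fun S => ∑ i ∈ (S : Finset (Fin n)), (i : ℕ)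
  have hzero : ∀ S T, w T ≤ w S → S ≠ T → M S T = 0 := fun S T h hne => by
    rw [hentry, Matrix.sub_apply, Matrix.of_apply, det_minor_eq_zero hg h hne,
      Matrix.one_apply_ne hne, sub_zero]
  have hdiag : ∀ S, M S S = 1 - ∏ i ∈ (S : Finset (Fin n)), A i i := fun S => by
    rw [hentry, Matrix.sub_apply, Matrix.of_apply, det_minor_self hg, Matrix.one_apply_eq]
  have htri : M.BlockTriangular w := fun S T h => hzero S T h.le fun e => by simp [e] at h
  have hblock : ∀ a, (M.toSquareBlock w a).det =
      ∏ S with w S = a, (1 - ∏ i ∈ (S : Finset (Fin n)), A i i) := fun a => by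
    rw [Finset.prod_subtype (p := fun S => w S = a) _ (by simp)]
    rw [← Matrix.det_diagonal]
    congr 1
    ext ⟨S, hS⟩ ⟨T, hT⟩
    by_cases h : S = T
    · subst h
      simp [Matrix.toSquareBlock_def, hdiag]
    · rw [Matrix.diagonal_apply_ne _ (by simpa using h)]
      exact hzero S T (by rw [hS, hT]) h
  rw [← LinearMap.det_toMatrix (b.exteriorPower k), ← hM, htri.det,
    Finset.prod_congr rfl fun a _ => hblock a,
    Finset.prod_fiberwise_of_maps_to fun S _ => Finset.mem_image_of_mem w (Finset.mem_univ S)]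
  exact (Finset.prod_subtype (Finset.powersetCard k Finset.univ)
    (p := fun S => S ∈ Set.powersetCard (Fin n) k) (by simp [Set.powersetCard.mem_iff])
    fun S => 1 - ∏ i ∈ S, A i i).symm

/-- Triangularization. The induction passes to the kernel of an eigenvector `φ` of the dual map, an
invariant hyperplane; a vector outside of it is added as the last basis vector. -/
theorem exists_basis_upperTriangular {K : Type*} [Field K] [IsAlgClosed K] (n : ℕ) :
    ∀ (V : Type _) [AddCommGroup V] [Module K V] [FiniteDimensional K V],
      Module.finrank K V = n → ∀ g : V →ₗ[K] V,
      ∃ b : Module.Basis (Fin n) K V, (LinearMap.toMatrix b b g).IsUpperTriangular := by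
  induction n with
  | zero =>
    intro V _ _ _ h g
    exact ⟨Module.finBasisOfFinrankEq K V h, fun i => i.elim0⟩
  | succ n ih =>
    intro V _ _ _ h g
    have : Nontrivial V := Module.nontrivial_of_finrank_pos (R := K) (by omega)
    obtain ⟨μ, hμ⟩ := Module.End.exists_eigenvalue (K := K) (V := Module.Dual K V) g.dualMap
    obtain ⟨φ, hφ, hφ0⟩ := hμ.exists_hasEigenvector
    rw [Module.End.mem_eigenspace_iff] at hφ
    have hφg : ∀ x, φ (g x) = μ * φ x := fun x => by
      simpa using LinearMap.congr_fun hφ x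
    obtain ⟨y, hy⟩ : ∃ y, φ y ≠ 0 := by
      by_contra! hc
      exact hφ0 (LinearMap.ext hc)
    have hmaps : ∀ x ∈ LinearMap.ker φ, g x ∈ LinearMap.ker φ := fun x hx => by
      rw [LinearMap.mem_ker] at hx ⊢
      rw [hφg, hx, mul_zero]
    have hdim : Module.finrank K (LinearMap.ker φ) = n := by
      have := Module.Dual.finrank_ker_add_one_of_ne_zero hφ0
      omega
    obtain ⟨b, hb⟩ := ih (LinearMap.ker φ) hdim (g.restrict hmaps)
    have hli : ∀ (c : K), ∀ x ∈ LinearMap.ker φ, c • y + x = 0 → c = 0 := fun c x hx hc => by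
      have := congrArg φ hc
      rw [LinearMap.mem_ker] at hx
      simpa [hx, hy] using this
    have hsp : ∀ z : V, ∃ c : K, z + c • y ∈ LinearMap.ker φ := fun z =>
      ⟨-(φ z / φ y), by simp [hy]⟩
    set B := Module.Basis.mkFinSnoc b y hli hsp with hB
    have hBc : ∀ j : Fin n, B j.castSucc = (b j : V) := fun j => by simp [hB]
    have hrep : ∀ x : LinearMap.ker φ, ∀ i : Fin n, B.repr (x : V) i.castSucc = b.repr x i ∧
        B.repr (x : V) (Fin.last n) = 0 := by
      intro x i
      have hx : (x : V) = ∑ j, b.repr x j • B j.castSucc := by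
        conv_lhs => rw [← b.sum_repr x]
        simp only [Submodule.coe_sum, Submodule.coe_smul, hBc]
      rw [hx]
      simp [Finsupp.single_apply, Fin.castSucc_ne_last]
    refine ⟨B, fun i j hij => ?_⟩
    simp only [id] at hij
    rw [LinearMap.toMatrix_apply]
    cases j using Fin.lastCases with
    | last => exact absurd hij (not_lt.2 (Fin.le_last i))
    | cast j =>
      have hgj : g (B j.castSucc) = ((g.restrict hmaps (b j) : LinearMap.ker φ) : V) := by
        rw [hBc]; rfl
      rw [hgj]
      cases i using Fin.lastCases with
      | last => exact (hrep _ j).2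
      | cast i =>
        rw [(hrep _ i).1, ← LinearMap.toMatrix_apply]
        exact hb (by simpa using hij)


theorem extPow_apply {n : ℕ} (k : ℕ) (A : Matrix (Fin n) (Fin n) ℤ)
    (S T : Set.powersetCard (Fin n) k) :
    extPow k A S T = (A.submatrix (Set.powersetCard.ofFinEmbEquiv.symm S)
        (Set.powersetCard.ofFinEmbEquiv.symm T)).det := by
  rw [extPow, toMatrix_exteriorPower_map_apply, ← Matrix.toLin_eq_toLin', LinearMap.toMatrix_toLin]

/-- The complex eigenvalues `l` of `A` determine both its characteristic polynomial and all the
determinants `det (I - ⋀ᵏA)`. -/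
theorem exists_eigenvalues (n : ℕ) (A : Matrix (Fin n) (Fin n) ℤ) :
    ∃ l : Fin n → ℂ, A.charpoly.map (Int.castRingHom ℂ) = ∏ i, (X - C (l i)) ∧
      ∀ k, ((1 - extPow k A).det : ℂ) =
        ∏ S ∈ Finset.powersetCard k Finset.univ, (1 - ∏ i ∈ S, l i) := by
  set B := A.map (Int.castRingHom ℂ)
  set g := Matrix.toLin' B
  obtain ⟨b, hb⟩ := exists_basis_upperTriangular (K := ℂ) n (Fin n → ℂ) (by simp) g
  refine ⟨fun i => LinearMap.toMatrix b b g i i, ?_, fun k => ?_⟩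
  · rw [← Matrix.charpoly_map, ← Matrix.charpoly_of_isUpperTriangular _ hb,
      LinearMap.charpoly_toMatrix, ← LinearMap.charpoly_toMatrix g (Pi.basisFun ℂ (Fin n)),
      LinearMap.toMatrix_eq_toMatrix', LinearMap.toMatrix'_toLin']
  · rw [← det_one_sub_exteriorPower_map b g hb,
      ← LinearMap.det_toMatrix ((Pi.basisFun ℂ (Fin n)).exteriorPower k), toMatrix_id_sub,
      Int.cast_det]
    congr 1
    ext S T
    rw [Matrix.sub_apply, toMatrix_exteriorPower_map_apply, LinearMap.toMatrix_eq_toMatrix',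
      LinearMap.toMatrix'_toLin', Matrix.map_apply, Matrix.sub_apply, extPow_apply, Int.cast_sub,
      Int.cast_det, Matrix.one_apply, Matrix.one_apply]
    congr 1
    split_ifs <;> simp

/-! ### Products over pairs of roots -/

/-- The value of `∏ (1 - λᵢλⱼ)`, over the pairs of roots of `x⁶ + c₅x⁵ + ⋯ + c₁x + 1`, as a polynomial
in the coefficients. -/
def pairInvariant {R : Type*} [CommRing R] (c₁ c₂ c₃ c₄ c₅ : R) : R :=
  -(c₄ - c₂) ^ 3 + 3 * (c₄ - c₂) * (c₅ - c₁) ^ 2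
    + c₁ * ((c₄ - c₂) ^ 2 * (c₅ - c₁) - 2 * (c₅ - c₁) ^ 3)
    - c₂ * (c₄ - c₂) * (c₅ - c₁) ^ 2 + c₃ * (c₅ - c₁) ^ 3 - (c₅ - c₁) ^ 4

/-- A square root of `∏ (1 - λᵢλⱼλₖ)`, over the triples of roots of `x⁶ + c₅x⁵ + ⋯ + c₁x + 1`, as a
polynomial in the coefficients. -/
def tripleInvariant {R : Type*} [CommRing R] (c₁ c₂ c₃ c₄ c₅ : R) : R :=
  -(c₁ * c₃ * c₅) - c₅ ^ 2 * c₂ - c₅ ^ 3 - c₄ * c₁ ^ 2 - c₁ ^ 3 + 4 * c₅ * c₄ + 2 * c₁ * c₅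
    + 4 * c₂ * c₄ - c₃ ^ 2 + 4 * c₁ * c₂ - 4 * c₃ - 4

/-- The product `∏ (1 - zλᵢλⱼ)` over the pairs among four elements with elementary symmetric functions
`s₁, …, s₄`. For `z ≠ 0` it is `z³` times the value at `1 / z + zs₄` of the
resolvent cubic, whose roots are the three sums of the form `λ₁λ₂ + λ₃λ₄`. -/
def quarticPairs {R : Type*} [CommRing R] (z s₁ s₂ s₃ s₄ : R) : R :=
  (1 + z ^ 2 * s₄) ^ 3 - z * s₂ * (1 + z ^ 2 * s₄) ^ 2
    + z ^ 2 * (s₁ * s₃ - 4 * s₄) * (1 + z ^ 2 * s₄)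
    - z ^ 3 * (s₃ ^ 2 + s₁ ^ 2 * s₄ - 4 * s₂ * s₄)

/-- The product `∏ (1 - zλᵢλⱼ)` over the pairs among five elements with elementary symmetric functions
`s₁, …, s₅`. -/
def quinticPairs {R : Type*} [CommRing R] (z s₁ s₂ s₃ s₄ s₅ : R) : R :=
  s₅ ^ 4 * z ^ 10 - s₃ * s₅ ^ 3 * z ^ 9 - s₁ * s₅ ^ 3 * z ^ 8 + s₂ * s₄ * s₅ ^ 2 * z ^ 8
    + 2 * s₁ * s₃ * s₅ ^ 2 * z ^ 7 - s₁ * s₄ ^ 2 * s₅ * z ^ 7 - s₂ ^ 2 * s₅ ^ 2 * z ^ 7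
    + s₁ * s₂ * s₄ * s₅ * z ^ 6 - s₁ ^ 2 * s₅ ^ 2 * z ^ 6 + s₄ * s₅ ^ 2 * z ^ 7
    - s₁ ^ 2 * s₃ * s₅ * z ^ 5 + s₂ * s₅ ^ 2 * z ^ 6 - 3 * s₃ * s₄ * s₅ * z ^ 6 + s₄ ^ 3 * z ^ 6
    + 2 * s₁ * s₄ * s₅ * z ^ 5 + s₁ ^ 3 * s₅ * z ^ 4 + 2 * s₂ * s₃ * s₅ * z ^ 5
    - s₂ * s₄ ^ 2 * z ^ 5 - 3 * s₁ * s₂ * s₅ * z ^ 4 + s₁ * s₃ * s₄ * z ^ 4 - 2 * s₅ ^ 2 * z ^ 5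
    - s₁ ^ 2 * s₄ * z ^ 3 + s₃ * s₅ * z ^ 4 - s₄ ^ 2 * z ^ 4 + s₁ * s₅ * z ^ 3 + 2 * s₂ * s₄ * z ^ 3
    - s₃ ^ 2 * z ^ 3 + s₁ * s₃ * z ^ 2 - s₄ * z ^ 2 - s₂ * z + 1

theorem prod_pairs_four {R : Type*} [CommRing R] (z a b c d : R) :
    (1 - z * a * b) * (1 - z * a * c) * (1 - z * a * d) * (1 - z * b * c) * (1 - z * b * d)
      * (1 - z * c * d) =
    quarticPairs z (a + b + c + d) (a * b + a * c + a * d + b * c + b * d + c * d)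
      (a * b * c + a * b * d + a * c * d + b * c * d) (a * b * c * d) := by
  simp only [quarticPairs]; ring

/-- Adjoining a fifth element `w`, whose pairs with the first four contribute the second factor. -/
theorem quarticPairs_mul {R : Type*} [CommRing R] (z w s₁ s₂ s₃ s₄ : R) :
    quarticPairs z s₁ s₂ s₃ s₄ *
      (1 - z * w * s₁ + (z * w) ^ 2 * s₂ - (z * w) ^ 3 * s₃ + (z * w) ^ 4 * s₄) =
    quinticPairs z (s₁ + w) (s₂ + w * s₁) (s₃ + w * s₂) (s₄ + w * s₃) (w * s₄) := by
  simp only [quarticPairs, quinticPairs]; ring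

/-- The left side singles out one root `z` among six with product `1`; after division by `z³` it is
symmetric in all six. -/
theorem quinticPairs_eq_tripleInvariant {K : Type*} [Field K] {z s₁ s₂ s₃ s₄ s₅ : K}
    (h : z * s₅ = 1) :
    quinticPairs z s₁ s₂ s₃ s₄ s₅ = z ^ 3 * tripleInvariant (-(s₅ + z * s₄)) (s₄ + z * s₃)
      (-(s₃ + z * s₂)) (s₂ + z * s₁) (-(s₁ + z)) := by
  have hz : z ≠ 0 := left_ne_zero_of_mul_eq_one h
  obtain rfl : s₅ = z⁻¹ := eq_inv_of_mul_eq_one_right h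
  simp only [quinticPairs, tripleInvariant]
  field_simp
  ring

theorem quinticPairs_mul_eq_pairInvariant {K : Type*} [Field K] {z s₁ s₂ s₃ s₄ s₅ : K}
    (h : z * s₅ = 1) :
    quinticPairs 1 s₁ s₂ s₃ s₄ s₅ *
        (1 - z * s₁ + z ^ 2 * s₂ - z ^ 3 * s₃ + z ^ 4 * s₄ - z ^ 5 * s₅) =
      pairInvariant (-(s₅ + z * s₄)) (s₄ + z * s₃) (-(s₃ + z * s₂)) (s₂ + z * s₁)
        (-(s₁ + z)) := by
  have hz : z ≠ 0 := left_ne_zero_of_mul_eq_one h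
  obtain rfl : s₅ = z⁻¹ := eq_inv_of_mul_eq_one_right h
  simp only [quinticPairs, pairInvariant]
  field_simp
  ring

theorem prod_pairs_five {R : Type*} [CommRing R] (z a b c d e : R) :
    (1 - z * a * b) * (1 - z * a * c) * (1 - z * a * d) * (1 - z * b * c) * (1 - z * b * d)
      * (1 - z * c * d) * ((1 - z * a * e) * (1 - z * b * e) * (1 - z * c * e) * (1 - z * d * e)) =
    quinticPairs z (a + b + c + d + e)
      (a * b + a * c + a * d + b * c + b * d + c * d + e * (a + b + c + d))
      (a * b * c + a * b * d + a * c * d + b * c * d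
        + e * (a * b + a * c + a * d + b * c + b * d + c * d))
      (a * b * c * d + e * (a * b * c + a * b * d + a * c * d + b * c * d))
      (e * (a * b * c * d)) := by
  rw [prod_pairs_four, ← quarticPairs_mul]
  ring

/-! ### The determinants of order six -/

theorem prod_pairs_five_one {R : Type*} [CommRing R] (a b c d e : R) :
    (1 - a * b) * (1 - a * c) * (1 - a * d) * (1 - b * c) * (1 - b * d)
      * (1 - c * d) * ((1 - a * e) * (1 - b * e) * (1 - c * e) * (1 - d * e)) =
    quinticPairs 1 (a + b + c + d + e)
      (a * b + a * c + a * d + b * c + b * d + c * d + e * (a + b + c + d))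
      (a * b * c + a * b * d + a * c * d + b * c * d
        + e * (a * b + a * c + a * d + b * c + b * d + c * d))
      (a * b * c * d + e * (a * b * c + a * b * d + a * c * d + b * c * d))
      (e * (a * b * c * d)) := by
  simpa using prod_pairs_five 1 a b c d e

/-- The coefficients of a sextic in terms of one root `z` and the elementary symmetric functions `sᵢ` of
the other five. -/
theorem coeff_of_eq_prod {K : Type*} [Field K] {P : K[X]} {a b c d e z : K}
    (h : P = (X - C a) * (X - C b) * (X - C c) * (X - C d) * (X - C e) * (X - C z)) :
    ∃ s₁ s₂ s₃ s₄ s₅ : K,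
      s₁ = a + b + c + d + e ∧
      s₂ = a * b + a * c + a * d + b * c + b * d + c * d + e * (a + b + c + d) ∧
      s₃ = a * b * c + a * b * d + a * c * d + b * c * d
        + e * (a * b + a * c + a * d + b * c + b * d + c * d) ∧
      s₄ = a * b * c * d + e * (a * b * c + a * b * d + a * c * d + b * c * d) ∧
      s₅ = e * (a * b * c * d) ∧
      P.coeff 0 = z * s₅ ∧ P.coeff 1 = -(s₅ + z * s₄) ∧ P.coeff 2 = s₄ + z * s₃ ∧
      P.coeff 3 = -(s₃ + z * s₂) ∧ P.coeff 4 = s₂ + z * s₁ ∧ P.coeff 5 = -(s₁ + z) := by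
  refine ⟨_, _, _, _, _, rfl, rfl, rfl, rfl, rfl, ?_⟩
  generalize h₁ : a + b + c + d + e = s₁
  generalize h₂ : a * b + a * c + a * d + b * c + b * d + c * d + e * (a + b + c + d) = s₂
  generalize h₃ : a * b * c + a * b * d + a * c * d + b * c * d
        + e * (a * b + a * c + a * d + b * c + b * d + c * d) = s₃
  generalize h₄ : a * b * c * d + e * (a * b * c + a * b * d + a * c * d + b * c * d) = s₄
  generalize h₅ : e * (a * b * c * d) = s₅
  have hP : P = X ^ 6 - C (s₁ + z) * X ^ 5 + C (s₂ + z * s₁) * X ^ 4 - C (s₃ + z * s₂) * X ^ 3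
      + C (s₄ + z * s₃) * X ^ 2 - C (s₅ + z * s₄) * X + C (z * s₅) := by
    rw [h, ← h₁, ← h₂, ← h₃, ← h₄, ← h₅]
    simp only [map_add, map_mul]
    ring
  rw [hP]
  simp only [coeff_add, coeff_sub, coeff_C_mul, coeff_X_pow, coeff_X, coeff_C]
  norm_num

/-- The three determinants in terms of the characteristic polynomial. For `k = 3` complementary triples
have inverse products, so that `det (1 - ⋀³A)` is a square. -/
theorem det_one_sub_extPow {A : Matrix (Fin 6) (Fin 6) ℤ} (hdet : A.det = 1) :
    (1 - extPow 1 A).det = A.charpoly.eval 1 ∧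
    (1 - extPow 2 A).det = pairInvariant (A.charpoly.coeff 1) (A.charpoly.coeff 2)
      (A.charpoly.coeff 3) (A.charpoly.coeff 4) (A.charpoly.coeff 5) ∧
    (1 - extPow 3 A).det = tripleInvariant (A.charpoly.coeff 1) (A.charpoly.coeff 2)
      (A.charpoly.coeff 3) (A.charpoly.coeff 4) (A.charpoly.coeff 5) ^ 2 := by
  obtain ⟨l, hl, hdets⟩ := exists_eigenvalues 6 A
  have hprod := hl
  rw [Fin.prod_univ_six] at hprod
  obtain ⟨s₁, s₂, s₃, s₄, s₅, h₁, h₂, h₃, h₄, h₅, hc0, hc1, hc2, hc3, hc4, hc5⟩ :=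
    coeff_of_eq_prod hprod
  simp only [coeff_map, eq_intCast] at hc0 hc1 hc2 hc3 hc4 hc5
  have hz : l 5 * s₅ = 1 := by
    rw [← hc0, ← Int.cast_one, ← hdet, Matrix.det_eq_sign_charpoly_coeff]
    simp
  have h1 := hdets 1
  have h2 := hdets 2
  have h3 := hdets 3
  rw [show Finset.powersetCard 1 (Finset.univ : Finset (Fin 6)) =
    {{0}, {1}, {2}, {3}, {4}, {5}} by decide] at h1
  rw [show Finset.powersetCard 2 (Finset.univ : Finset (Fin 6)) =
    {{0, 1}, {0, 2}, {0, 3}, {0, 4}, {0, 5}, {1, 2}, {1, 3}, {1, 4}, {1, 5}, {2, 3}, {2, 4},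
      {2, 5}, {3, 4}, {3, 5}, {4, 5}} by decide] at h2
  rw [show Finset.powersetCard 3 (Finset.univ : Finset (Fin 6)) =
    {{0, 1, 2}, {0, 1, 3}, {0, 1, 4}, {0, 1, 5}, {0, 2, 3}, {0, 2, 4}, {0, 2, 5}, {0, 3, 4},
      {0, 3, 5}, {0, 4, 5}, {1, 2, 3}, {1, 2, 4}, {1, 2, 5}, {1, 3, 4}, {1, 3, 5}, {1, 4, 5},
      {2, 3, 4}, {2, 3, 5}, {2, 4, 5}, {3, 4, 5}} by decide] at h3
  repeat rw [Finset.prod_insert (by decide)] at h1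
  repeat rw [Finset.prod_insert (by decide)] at h2
  repeat rw [Finset.prod_insert (by decide)] at h3
  simp only [Finset.prod_singleton] at h1 h2 h3
  repeat rw [Finset.prod_insert (by decide)] at h2
  repeat rw [Finset.prod_insert (by decide)] at h3
  simp only [Finset.prod_singleton] at h2 h3
  generalize l 0 = a at *
  generalize l 1 = b at *
  generalize l 2 = c at *
  generalize l 3 = d at *
  generalize l 4 = e at *
  generalize l 5 = z at *
  refine ⟨?_, ?_, ?_⟩
  · apply Int.cast_injective (α := ℂ)
    have := congrArg (eval 1) hprod
    rw [eval_one_map] at this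
    rw [h1]
    simp only [eval_mul, eval_sub, eval_X, eval_C, eq_intCast] at this
    rw [this]
    ring
  · apply Int.cast_injective (α := ℂ)
    rw [h2]
    have hcast : ((pairInvariant (A.charpoly.coeff 1) (A.charpoly.coeff 2)
      (A.charpoly.coeff 3) (A.charpoly.coeff 4) (A.charpoly.coeff 5) : ℤ) : ℂ) =
        pairInvariant (A.charpoly.coeff 1 : ℂ) (A.charpoly.coeff 2)
      (A.charpoly.coeff 3) (A.charpoly.coeff 4) (A.charpoly.coeff 5) := by
      simp only [pairInvariant]; push_cast; rfl
    rw [hcast, hc1, hc2, hc3, hc4, hc5, ← quinticPairs_mul_eq_pairInvariant hz, h₁, h₂, h₃, h₄, h₅,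
      ← prod_pairs_five_one]
    have hlin : 1 - z * (a + b + c + d + e)
        + z ^ 2 * (a * b + a * c + a * d + b * c + b * d + c * d + e * (a + b + c + d))
        - z ^ 3 * (a * b * c + a * b * d + a * c * d + b * c * d
          + e * (a * b + a * c + a * d + b * c + b * d + c * d))
        + z ^ 4 * (a * b * c * d + e * (a * b * c + a * b * d + a * c * d + b * c * d))
        - z ^ 5 * (e * (a * b * c * d)) =
        (1 - a * z) * (1 - b * z) * (1 - c * z) * (1 - d * z) * (1 - e * z) := by ring
    rw [hlin]
    -- the fifteen factors are made opaque, so that only their order has to be compared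
    generalize 1 - a * b = m₁
    generalize 1 - a * c = m₂
    generalize 1 - a * d = m₃
    generalize 1 - a * e = m₄
    generalize 1 - a * z = m₅
    generalize 1 - b * c = m₆
    generalize 1 - b * d = m₇
    generalize 1 - b * e = m₈
    generalize 1 - b * z = m₉
    generalize 1 - c * d = n₁
    generalize 1 - c * e = n₂
    generalize 1 - c * z = n₃
    generalize 1 - d * e = n₄
    generalize 1 - d * z = n₅
    generalize 1 - e * z = n₆
    ring
  · apply Int.cast_injective (α := ℂ)
    rw [h3]
    have hcast : ((tripleInvariant (A.charpoly.coeff 1) (A.charpoly.coeff 2)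
      (A.charpoly.coeff 3) (A.charpoly.coeff 4) (A.charpoly.coeff 5) : ℤ) : ℂ) =
        tripleInvariant (A.charpoly.coeff 1 : ℂ) (A.charpoly.coeff 2)
      (A.charpoly.coeff 3) (A.charpoly.coeff 4) (A.charpoly.coeff 5) := by
      simp only [tripleInvariant]; push_cast; rfl
    have hE := prod_pairs_five z a b c d e
    rw [← h₁, ← h₂, ← h₃, ← h₄, ← h₅, quinticPairs_eq_tripleInvariant hz, ← hc1, ← hc2, ← hc3,
      ← hc4, ← hc5] at hE
    -- each of the ten triples without `z` is the inverse of a triple containing `z`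
    have key : ∀ x y u v w : ℂ, z * (x * y * u * v * w) = 1 →
        1 - u * (v * w) = -(u * v * w) * (1 - z * x * y) := fun x y u v w h => by
      linear_combination -h
    have hz' : z * (a * b * c * d * e) = 1 := by rw [← hz, h₅]; ring
    rw [key d e a b c (by rw [← hz']; ring), key c e a b d (by rw [← hz']; ring),
      key c d a b e (by rw [← hz']; ring), key b e a c d (by rw [← hz']; ring),
      key b d a c e (by rw [← hz']; ring), key b c a d e (by rw [← hz']; ring),
      key a e b c d (by rw [← hz']; ring), key a d b c e (by rw [← hz']; ring),
      key a c b d e (by rw [← hz']; ring), key a b c d e hz']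
    push_cast
    rw [hcast]
    generalize tripleInvariant (A.charpoly.coeff 1 : ℂ) (A.charpoly.coeff 2)
      (A.charpoly.coeff 3) (A.charpoly.coeff 4) (A.charpoly.coeff 5) = W at *
    have hcomm : ∀ x y : ℂ, 1 - x * (y * z) = 1 - z * x * y := fun x y => by ring
    have h6 : (z * (a * b * c * d * e)) ^ 6 = 1 := by rw [hz', one_pow]
    calc _ = (a * b * c * d * e) ^ 6 * ((1 - z * a * b) * (1 - z * a * c) * (1 - z * a * d) *
          (1 - z * b * c) * (1 - z * b * d) * (1 - z * c * d) *
          ((1 - z * a * e) * (1 - z * b * e) * (1 - z * c * e) * (1 - z * d * e))) ^ 2 := by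
          simp only [hcomm]
          generalize 1 - z * a * b = m₁
          generalize 1 - z * a * c = m₂
          generalize 1 - z * a * d = m₃
          generalize 1 - z * a * e = m₄
          generalize 1 - z * b * c = m₅
          generalize 1 - z * b * d = m₆
          generalize 1 - z * b * e = m₇
          generalize 1 - z * c * d = m₈
          generalize 1 - z * c * e = m₉
          generalize 1 - z * d * e = m₀
          ring
      _ = (z * (a * b * c * d * e)) ^ 6 * W ^ 2 := by rw [hE]; ring
      _ = _ := by rw [h6, one_mul]

/-! ### Cappell-Shaneson tuples -/

/-- Every monic polynomial is a characteristic polynomial: multiplication by the root in `R[X]/(f)`. -/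
theorem exists_charpoly_eq {R : Type*} [CommRing R] [Nontrivial R] {f : R[X]} (hf : f.Monic)
    {n : ℕ} (hn : f.natDegree = n) : ∃ A : Matrix (Fin n) (Fin n) R, A.charpoly = f := by
  let pb := AdjoinRoot.powerBasis' hf
  have hdim : pb.dim = n := by rw [AdjoinRoot.powerBasis'_dim, hn]
  have hmin : minpoly R pb.gen = f := by
    symm
    refine minpoly.unique' R pb.gen hf ?_ fun q hq => or_iff_not_imp_left.2 fun h0 hroot => ?_
    · simp [pb]
    · refine hf.not_dvd_of_degree_lt h0 hq ?_
      rwa [AdjoinRoot.powerBasis'_gen, AdjoinRoot.aeval_eq, AdjoinRoot.mk_eq_zero] at hroot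
  refine ⟨Matrix.reindex (finCongr hdim) (finCongr hdim)
    (Algebra.leftMulMatrix pb.basis pb.gen), ?_⟩
  rw [Matrix.charpoly_reindex, charpoly_leftMulMatrix, hmin]

/-- The conditions on `(c₀, …, c₅)` that make `x⁶ + c₅x⁵ + ⋯ + c₀` a Cappell-Shaneson polynomial. That a
quantity is `±1` is expressed through its square. -/
def IsCSTuple (c : Fin 6 → ℤ) : Prop :=
  c 0 = 1 ∧
    (1 + c 0 + c 1 + c 2 + c 3 + c 4 + c 5) ^ 2 = 1 ∧
    pairInvariant (c 1) (c 2) (c 3) (c 4) (c 5) ^ 2 = 1 ∧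
    tripleInvariant (c 1) (c 2) (c 3) (c 4) (c 5) ^ 2 = 1

theorem isCSPolynomial_iff {f : ℤ[X]} (hf : f.Monic) (hdeg : f.natDegree = 6) :
    IsCSPolynomial 6 f ↔ IsCSTuple fun i => f.coeff i := by
  have key : ∀ A : Matrix (Fin 6) (Fin 6) ℤ, A.charpoly = f → (A.det = f.coeff 0) := fun A h => by
    rw [Matrix.det_eq_sign_charpoly_coeff, h]; simp
  have heval : f.eval 1 = 1 + f.coeff 0 + f.coeff 1 + f.coeff 2 + f.coeff 3 + f.coeff 4
      + f.coeff 5 := by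
    have h6 : f.coeff 6 = 1 := by rw [← hdeg]; exact hf.coeff_natDegree
    rw [eval_eq_sum_range, hdeg]
    simp [Finset.sum_range_succ, h6]
    ring
  have hmain : ∀ A : Matrix (Fin 6) (Fin 6) ℤ, A.charpoly = f → A.det = 1 →
      ((∀ k, 1 ≤ k → k ≤ 6 / 2 → CSCond k A) ↔ IsCSTuple fun i => f.coeff i) := by
    intro A hA hdet
    obtain ⟨h1, h2, h3⟩ := det_one_sub_extPow hdet
    rw [hA] at h1 h2 h3
    have h0 := key A hA
    have : (∀ k, 1 ≤ k → k ≤ 6 / 2 → CSCond k A) ↔ CSCond 1 A ∧ CSCond 2 A ∧ CSCond 3 A :=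
      ⟨fun h => ⟨h 1 (by norm_num) (by norm_num), h 2 (by norm_num) (by norm_num),
        h 3 (by norm_num) (by norm_num)⟩, fun h k hk1 hk3 => by
        obtain rfl | rfl | rfl : k = 1 ∨ k = 2 ∨ k = 3 := by omega
        exacts [h.1, h.2.1, h.2.2]⟩
    rw [this, IsCSTuple]
    simp only [CSCond, ← sq_eq_one_iff, h1, h2, h3, heval]
    have hsq : ∀ x : ℤ, (x ^ 2) ^ 2 = 1 ↔ x ^ 2 = 1 := fun x =>
      pow_eq_one_iff_of_nonneg (sq_nonneg x) two_ne_zero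
    exact ⟨fun h => ⟨h0.symm.trans hdet, h.1, h.2.1, (hsq _).1 h.2.2⟩,
      fun h => ⟨h.2.1, h.2.2.1, (hsq _).2 h.2.2.2⟩⟩
  constructor
  · rintro ⟨A, hA, hf'⟩
    exact (hmain A hf' A.2).1 hA
  · intro h
    obtain ⟨A, hA⟩ := exists_charpoly_eq hf hdeg
    have hdet : A.det = 1 := (key A hA).trans h.1
    exact ⟨⟨A, hdet⟩, (hmain A hA hdet).2 h, hA⟩

/-! ### The equations for a fixed coefficient difference -/

/-- The tuple with constant coefficient `1`, differences `q = c₅ - c₁` and `p = c₄ - c₂`, and value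
`u = f(1)`, which determines `c₃`. -/
def tupleOf (q u p c₁ c₂ : ℤ) : Fin 6 → ℤ :=
  ![1, c₁, c₂, u - 2 - q - p - 2 * c₁ - 2 * c₂, c₂ + p, c₁ + q]

/-- For given `q`, `p` and `u` the pair condition is linear in `c₁` and `c₂`, and it makes `p + 2q` a
divisor of `v - uq³`, where `v = ±1` is the value of the invariant. -/
theorem pairInvariant_tupleOf (q u p c₁ c₂ : ℤ) :
    pairInvariant c₁ c₂ (u - 2 - q - p - 2 * c₁ - 2 * c₂) (c₂ + p) (c₁ + q) =
      u * q ^ 3 + (p + 2 * q) * (q * (c₁ * (p - 2 * q) - c₂ * q) - q ^ 3 - (p - q) ^ 2) := by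
  simp only [pairInvariant]; ring

/-- Once `c₃` is eliminated, the triple condition is quadratic in `c₁` and linear in `c₂`. -/
theorem tripleInvariant_tupleOf (q u p c₁ c₂ : ℤ) (hu : u ^ 2 = 1) :
    tripleInvariant c₁ c₂ (u - 2 - q - p - 2 * c₁ - 2 * c₂) (c₂ + p) (c₁ + q) =
      -(u * c₁ ^ 2) + (p * q - q * u - 2 * q ^ 2 + 4 * u) * c₁ + (4 * u - q ^ 2) * c₂
        + (-q ^ 3 + 2 * p * q + 2 * p * u - p ^ 2 + 2 * q * u - q ^ 2 - 1) := by
  simp only [tripleInvariant]; linear_combination -hu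

/-- A decision procedure for the tuples with parameters `q`, `u`, triple invariant `w`, and
factorization `d * m = v - uq³`, where `d = p + 2q`. The factor `m` determines the integer
`L = c₁(p - 2q) - c₂q`; eliminating `c₂` from `q` times the triple condition leaves
`Ac₁² + Bc₁ + C = 0`. The discriminant `D` has to be either negative, or strictly between two
consecutive squares, or the square of an `s` such that each integral solution is in the table. -/
def sporadicCheck (q u w d m : ℤ) : Bool :=
  let p := d - 2 * q
  let M := m + q ^ 3 + (p - q) ^ 2
  let L := M / q
  let A := -(u * q)
  let B := q * (p * q - q * u - 2 * q ^ 2 + 4 * u) + (4 * u - q ^ 2) * (p - 2 * q)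
  let C := q * (-q ^ 3 + 2 * p * q + 2 * p * u - p ^ 2 + 2 * q * u - q ^ 2 - 1 - w)
    - (4 * u - q ^ 2) * L
  let D := B ^ 2 - 4 * A * C
  let s : ℤ := Nat.sqrt D.toNat
  if M % q = 0 then
    if s ^ 2 = D then
      ∀ t ∈ [s, -s], (t - B) % (2 * A) = 0 → ((t - B) / (2 * A) * (p - 2 * q) - L) % q = 0 →
        ∃ r ∈ table, r.coeffs 0 = tupleOf q u p ((t - B) / (2 * A))
          (((t - B) / (2 * A) * (p - 2 * q) - L) / q)
    else D < 0 ∨ s ^ 2 < D ∧ D < (s + 1) ^ 2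
  else true

theorem exists_mem_table_of_sporadicCheck {q u w d m c₁ c₂ : ℤ} (hq : 0 < q) (hu : u ^ 2 = 1)
    (h : sporadicCheck q u w d m = true)
    (hm : q * (c₁ * (d - 2 * q - 2 * q) - c₂ * q) - q ^ 3 - (d - 2 * q - q) ^ 2 = m)
    (hw : tripleInvariant c₁ c₂ (u - 2 - q - (d - 2 * q) - 2 * c₁ - 2 * c₂) (c₂ + (d - 2 * q))
      (c₁ + q) = w) :
    ∃ r ∈ table, ∃ a, tupleOf q u (d - 2 * q) c₁ c₂ = r.coeffs a := by
  rw [tripleInvariant_tupleOf _ _ _ _ _ hu] at hw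
  simp only [sporadicCheck] at h
  generalize d - 2 * q = p at *
  have hM : m + q ^ 3 + (p - q) ^ 2 = q * (c₁ * (p - 2 * q) - c₂ * q) := by linarith
  rw [hM, Int.mul_ediv_cancel_left _ hq.ne', if_pos (Int.mul_emod_right _ _)] at h
  set A := -(u * q) with hA
  set B := q * (p * q - q * u - 2 * q ^ 2 + 4 * u) + (4 * u - q ^ 2) * (p - 2 * q) with hB
  set C := q * (-q ^ 3 + 2 * p * q + 2 * p * u - p ^ 2 + 2 * q * u - q ^ 2 - 1 - w)
    - (4 * u - q ^ 2) * (c₁ * (p - 2 * q) - c₂ * q) with hC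
  have hu0 : u ≠ 0 := by rintro rfl; norm_num at hu
  have hA0 : 2 * A ≠ 0 := by
    rw [hA]; exact mul_ne_zero two_ne_zero (neg_ne_zero.2 (mul_ne_zero hu0 hq.ne'))
  have hquad : A * c₁ ^ 2 + B * c₁ + C = 0 := by
    rw [hA, hB, hC, ← hw]; ring
  have hD : (2 * A * c₁ + B) ^ 2 = B ^ 2 - 4 * A * C := by linear_combination 4 * A * hquad
  rw [← hD] at h
  set t := 2 * A * c₁ + B with ht
  have hs : ((t ^ 2).toNat.sqrt : ℤ) = |t| := by
    rw [← Int.natAbs_sq, ← Int.natCast_natAbs]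
    norm_cast
    rw [Nat.sqrt_eq']
  rw [hs, if_pos (sq_abs t)] at h
  have hmem : t ∈ [|t|, -|t|] := by
    rcases abs_choice t with h | h <;> simp [h]
  have htB : t - B = 2 * A * c₁ := by rw [ht]; ring
  have h' := (decide_eq_true_iff.1 h) t hmem
  have hL : c₁ * (p - 2 * q) - (c₁ * (p - 2 * q) - c₂ * q) = q * c₂ := by ring
  rw [htB, Int.mul_ediv_cancel_left _ hA0, hL, Int.mul_ediv_cancel_left _ hq.ne'] at h'
  obtain ⟨r, hr, hc⟩ := h' (Int.mul_emod_right _ _) (Int.mul_emod_right _ _)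
  exact ⟨r, hr, 0, hc.symm⟩

/-- Since `|v - uq³| ≤ 1729 < 42²` in the range considered, one of the two factors of any factorization
is less than `42` in absolute value. The value `e = 0` is void, as `N % 0 = N ≠ 0`. -/
theorem sporadicCheck_factorizations : ∀ q ∈ (List.range 13).tail, ∀ u ∈ [1, -1], ∀ v ∈ [1, -1],
    v ≠ u * (q : ℤ) ^ 3 → ∀ w ∈ [1, -1], ∀ e ∈ List.range 42, (v - u * (q : ℤ) ^ 3) % e = 0 →
      ∀ s ∈ [1, -1],
      sporadicCheck q u w (s * e) ((v - u * (q : ℤ) ^ 3) / (s * e)) = true ∧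
      sporadicCheck q u w ((v - u * (q : ℤ) ^ 3) / (s * e)) (s * e) = true := by
  decide +kernel

/-! ### Classification of the tuples -/

theorem tupleOf_eq {q u p c₁ c₂ t₁ t₂ t₃ t₄ t₅ : ℤ} (h1 : c₁ = t₁)
    (h2 : c₂ = t₂) (h3 : u - 2 - q - p - 2 * c₁ - 2 * c₂ = t₃) (h4 : c₂ + p = t₄)
    (h5 : c₁ + q = t₅) : tupleOf q u p c₁ c₂ = ![1, t₁, t₂, t₃, t₄, t₅] := by
  rw [tupleOf, h3, h4, h5, h1, h2]

theorem exists_mem_table_of_difference_zero {u w p c₁ c₂ : ℤ} (hu : u = 1 ∨ u = -1)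
    (hw : w = 1 ∨ w = -1) (hp : p = 1 ∨ p = -1)
    (h : tripleInvariant c₁ c₂ (u - 2 - 0 - p - 2 * c₁ - 2 * c₂) (c₂ + p) (c₁ + 0) = w) :
    ∃ r ∈ table, ∃ a, tupleOf 0 u p c₁ c₂ = r.coeffs a := by
  rw [tripleInvariant_tupleOf _ _ _ _ _ (sq_eq_one_iff.2 hu)] at h
  -- modulo `4` the equation forces `c₁` to be odd and `w = -u`
  obtain ⟨a, rfl | rfl⟩ : ∃ a, c₁ = 2 * a ∨ c₁ = 2 * a + 1 := ⟨c₁ / 2, by omega⟩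
  · ring_nf at h
    rcases hu with rfl | rfl <;> rcases hw with rfl | rfl <;> rcases hp with rfl | rfl <;> omega
  · ring_nf at h
    rcases hu with rfl | rfl <;> rcases hw with rfl | rfl <;> rcases hp with rfl | rfl <;>
      first
      | omega
      | refine ⟨table[0], List.getElem_mem _, a, tupleOf_eq ?_ ?_ ?_ ?_ ?_⟩ <;> ring_nf <;> omega
      | refine ⟨table[1], List.getElem_mem _, a, tupleOf_eq ?_ ?_ ?_ ?_ ?_⟩ <;> ring_nf <;> omega
      | refine ⟨table[2], List.getElem_mem _, a, tupleOf_eq ?_ ?_ ?_ ?_ ?_⟩ <;> ring_nf <;> omega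
      | refine ⟨table[3], List.getElem_mem _, a, tupleOf_eq ?_ ?_ ?_ ?_ ?_⟩ <;> ring_nf <;> omega

/-- For `q = 1` and `v = u` the product in the pair condition vanishes, which leaves infinitely many
`p`; each of the two factors leads to families with one parameter. -/
theorem exists_mem_table_of_difference_one {u w p c₁ c₂ : ℤ} (hu : u = 1 ∨ u = -1)
    (hw : w = 1 ∨ w = -1)
    (hp : (p + 2) * (1 * (c₁ * (p - 2 * 1) - c₂ * 1) - 1 ^ 3 - (p - 1) ^ 2) = 0)
    (h : tripleInvariant c₁ c₂ (u - 2 - 1 - p - 2 * c₁ - 2 * c₂) (c₂ + p) (c₁ + 1) = w) :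
    ∃ r ∈ table, ∃ a, tupleOf 1 u p c₁ c₂ = r.coeffs a := by
  rw [tripleInvariant_tupleOf _ _ _ _ _ (sq_eq_one_iff.2 hu)] at h
  rcases mul_eq_zero.1 hp with hp | hp
  · obtain rfl : p = -2 := by omega
    rcases hu with rfl | rfl
    · obtain ⟨a, rfl | rfl | rfl⟩ : ∃ a, c₁ = 3 * a - 1 ∨ c₁ = 3 * a ∨ c₁ = 3 * a + 1 :=
        ⟨(c₁ + 1) / 3, by omega⟩
      · ring_nf at h
        refine ⟨table[4], List.getElem_mem _, a, tupleOf_eq ?_ ?_ ?_ ?_ ?_⟩ <;> ring_nf <;> omega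
      · ring_nf at h
        refine ⟨table[5], List.getElem_mem _, a, tupleOf_eq ?_ ?_ ?_ ?_ ?_⟩ <;> ring_nf <;> omega
      · ring_nf at h
        omega
    · obtain ⟨a, rfl | rfl | rfl | rfl | rfl⟩ : ∃ a, c₁ = 5 * a - 2 ∨ c₁ = 5 * a - 1 ∨
          c₁ = 5 * a ∨ c₁ = 5 * a + 1 ∨ c₁ = 5 * a + 2 := ⟨(c₁ + 2) / 5, by omega⟩
      · ring_nf at h
        refine ⟨table[12], List.getElem_mem _, a, tupleOf_eq ?_ ?_ ?_ ?_ ?_⟩ <;> ring_nf <;> omega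
      · ring_nf at h
        refine ⟨table[13], List.getElem_mem _, a, tupleOf_eq ?_ ?_ ?_ ?_ ?_⟩ <;> ring_nf <;> omega
      · ring_nf at h
        refine ⟨table[14], List.getElem_mem _, a, tupleOf_eq ?_ ?_ ?_ ?_ ?_⟩ <;> ring_nf <;> omega
      · ring_nf at h
        omega
      · ring_nf at h
        refine ⟨table[15], List.getElem_mem _, a, tupleOf_eq ?_ ?_ ?_ ?_ ?_⟩ <;> ring_nf <;> omega
  · obtain rfl : c₂ = c₁ * (p - 2) - 1 - (p - 1) ^ 2 := by linarith
    -- in terms of `x`, the triple condition is a quadratic equation with constant coefficients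
    obtain ⟨x, rfl⟩ : ∃ x, c₁ = 2 * p - 2 + x := ⟨c₁ - 2 * p + 2, by ring⟩
    rcases hu with rfl | rfl
    · have hx : x ^ 2 + x + 1 + w = 0 := by linear_combination -h
      rcases hw with rfl | rfl
      · nlinarith [sq_nonneg (2 * x + 1)]
      · rcases mul_eq_zero.1 (show x * (x + 1) = 0 by linear_combination hx) with hx | hx
        · obtain rfl := hx
          refine ⟨table[7], List.getElem_mem _, p - 1, tupleOf_eq ?_ ?_ ?_ ?_ ?_⟩ <;> ring
        · obtain rfl : x = -1 := by omega
          refine ⟨table[6], List.getElem_mem _, p - 1, tupleOf_eq ?_ ?_ ?_ ?_ ?_⟩ <;> ring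
    · have hx : x ^ 2 + x - 1 - w = 0 := by linear_combination h
      rcases hw with rfl | rfl
      · rcases mul_eq_zero.1 (show (x + 2) * (x - 1) = 0 by linear_combination hx) with hx | hx
        · obtain rfl : x = -2 := by omega
          refine ⟨table[19], List.getElem_mem _, p - 2, tupleOf_eq ?_ ?_ ?_ ?_ ?_⟩ <;> ring
        · obtain rfl : x = 1 := by omega
          refine ⟨table[16], List.getElem_mem _, p, tupleOf_eq ?_ ?_ ?_ ?_ ?_⟩ <;> ring
      · rcases mul_eq_zero.1 (show x * (x + 1) = 0 by linear_combination hx) with hx | hx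
        · obtain rfl := hx
          refine ⟨table[17], List.getElem_mem _, p - 1, tupleOf_eq ?_ ?_ ?_ ?_ ?_⟩ <;> ring
        · obtain rfl : x = -1 := by omega
          refine ⟨table[18], List.getElem_mem _, p - 1, tupleOf_eq ?_ ?_ ?_ ?_ ?_⟩ <;> ring

theorem exists_mem_table_of_ne {q u v w p c₁ c₂ : ℤ} (hq0 : 0 < q) (hq12 : q ≤ 12)
    (hu : u = 1 ∨ u = -1) (hv : v = 1 ∨ v = -1) (hw : w = 1 ∨ w = -1) (hne : v ≠ u * q ^ 3)
    (hp : (p + 2 * q) * (q * (c₁ * (p - 2 * q) - c₂ * q) - q ^ 3 - (p - q) ^ 2) = v - u * q ^ 3)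
    (h : tripleInvariant c₁ c₂ (u - 2 - q - p - 2 * c₁ - 2 * c₂) (c₂ + p) (c₁ + q) = w) :
    ∃ r ∈ table, ∃ a, tupleOf q u p c₁ c₂ = r.coeffs a := by
  have hcheck := sporadicCheck_factorizations
  obtain ⟨d, rfl⟩ : ∃ d, p = d - 2 * q := ⟨p + 2 * q, by ring⟩
  rw [sub_add_cancel] at hp
  set m := q * (c₁ * (d - 2 * q - 2 * q) - c₂ * q) - q ^ 3 - (d - 2 * q - q) ^ 2 with hm
  refine exists_mem_table_of_sporadicCheck (d := d) (m := m) hq0 (sq_eq_one_iff.2 hu) ?_ rfl h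
  have hN0 : d * m ≠ 0 := by rw [hp]; exact sub_ne_zero.2 hne
  have hd0 := left_ne_zero_of_mul hN0
  have hm0 := right_ne_zero_of_mul hN0
  have hN : |d| * |m| ≤ 1729 := by
    have : q ^ 3 ≤ 12 ^ 3 := by gcongr
    have : 0 < q ^ 3 := by positivity
    rw [← abs_mul, hp, abs_le]
    rcases hu with rfl | rfl <;> rcases hv with rfl | rfl <;> constructor <;> omega
  lift q to ℕ using hq0.le
  have hspec : ∀ x y : ℤ, x * y = v - u * q ^ 3 → x ≠ 0 → |x| < 42 →
      sporadicCheck q u w x y = true ∧ sporadicCheck q u w y x = true := by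
    intro x y hxy hx0 hx
    have hs : ∃ s ∈ ([1, -1] : List ℤ), x = s * x.natAbs := by
      rcases Int.natAbs_eq x with h | h
      · exact ⟨1, by simp, by omega⟩
      · exact ⟨-1, by simp, by omega⟩
    obtain ⟨s, hs, hxs⟩ := hs
    have := hcheck q (by
      have : q = 0 ∨ q ∈ (List.range 13).tail := by
        have : q < 13 := by omega
        interval_cases q <;> decide
      rcases this with h | h
      · omega
      · exact h) u (by simpa using hu) v (by simpa using hv) hne w (by simpa using hw) x.natAbs
        (List.mem_range.2 (by rw [Int.abs_eq_natAbs] at hx; omega)) (by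
          rw [← hxy, Int.emod_eq_zero_of_dvd]
          exact Dvd.dvd.mul_right (Int.natAbs_dvd.2 dvd_rfl) _) s hs
    rwa [← hxs, ← hxy, Int.mul_ediv_cancel_left _ hx0] at this
  by_cases hd : |d| < 42
  · exact (hspec d m hp hd0 hd).1
  · refine (hspec m d (by rw [mul_comm, hp]) hm0 ?_).2
    by_contra hm'
    nlinarith

theorem exists_mem_table_of_isCSTuple {c : Fin 6 → ℤ} (hc : IsCSTuple c) (hq0 : 0 ≤ c 5 - c 1)
    (hq12 : c 5 - c 1 ≤ 12) : ∃ r ∈ table, ∃ a, c = r.coeffs a := by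
  obtain ⟨h0, h1, h2, h3⟩ := hc
  obtain ⟨q, hq⟩ : ∃ q, c 5 = c 1 + q := ⟨c 5 - c 1, by ring⟩
  obtain ⟨p, hp⟩ : ∃ p, c 4 = c 2 + p := ⟨c 4 - c 2, by ring⟩
  obtain ⟨u, hu⟩ : ∃ u, c 3 = u - 2 - q - p - 2 * c 1 - 2 * c 2 :=
    ⟨c 3 + (2 + q + p + 2 * c 1 + 2 * c 2), by ring⟩
  have hcu : c = tupleOf q u p (c 1) (c 2) := by
    ext i
    fin_cases i
    exacts [h0, rfl, rfl, hu, hp, hq]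
  rw [hcu]
  rw [hu, hp, hq] at h1 h2 h3
  rw [h0] at h1
  rw [hq] at hq0 hq12
  generalize c 1 = c₁ at *
  generalize c 2 = c₂ at *
  have hu1 : u = 1 ∨ u = -1 := sq_eq_one_iff.1 (by rw [← h1]; ring)
  have hw := sq_eq_one_iff.1 h3
  have hv := sq_eq_one_iff.1 h2
  rw [pairInvariant_tupleOf] at hv
  rcases eq_or_ne q 0 with rfl | hq0'
  · refine exists_mem_table_of_difference_zero hu1 hw ?_ rfl
    rw [← sq_eq_one_iff]
    have : (p ^ 2) ^ 3 = 1 := by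
      rw [← sq_eq_one_iff] at hv
      linear_combination hv
    exact (pow_eq_one_iff_of_nonneg (sq_nonneg p) three_ne_zero).1 this
  · obtain ⟨v, hv'⟩ : ∃ v, v = u * q ^ 3 +
      (p + 2 * q) * (q * (c₁ * (p - 2 * q) - c₂ * q) - q ^ 3 - (p - q) ^ 2) := ⟨_, rfl⟩
    rw [← hv'] at hv
    by_cases hne : v = u * q ^ 3
    · obtain rfl : q = 1 := by
        -- for `q ≥ 2` the modulus of `u * q ^ 3` is at least `8`
        have : 0 < q := by omega
        by_contra hq1
        have : (2 : ℤ) ^ 3 ≤ q ^ 3 := by gcongr; omega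
        rcases hu1 with rfl | rfl <;> omega
      refine exists_mem_table_of_difference_one hu1 hw ?_ rfl
      linear_combination hne - hv'
    · exact exists_mem_table_of_ne (by omega) (by omega) hu1 hv hw hne
        (by linear_combination -hv') rfl

theorem isCSTuple_of_mem_table : ∀ r ∈ table, ∀ a, IsCSTuple (r.coeffs a) := by
  simp only [table, List.forall_mem_cons]
  and_intros
  on_goal 94 => simp
  all_goals
    intro a
    refine ⟨rfl, ?_, ?_, ?_⟩ <;> simp [pairInvariant, tripleInvariant] <;> ring_nf <;> trivial

/-! ### Positivity

The rows of the table are numbered from `0`. In a one-parameter family with a bound on `a`, a substitution `a = e - b` with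
`b ≥ 0` turns `f(-s)` into a polynomial in `b` and `s` with nonnegative coefficients, apart from a few
values of `a` next to the bound. Beyond the bound, `f(-s)` is negative at a point close to one of its
approximate double zeros (near `s = a` or `s = 1 / a`), or, where `f(-s)` is asymptotically
`s⁴(s² - 5as + 5a²)`, near `s = 2a`; substituting `a = e + b` there gives nonpositive coefficients. -/

/-- The inequality `f(-s) > 0` for all `s > 0`, where `f = x⁶ + c₅x⁵ + ⋯ + c₀`. -/
def PosOnNeg (c : Fin 6 → ℤ) : Prop :=
  ∀ s : ℝ, 0 < s → 0 < s ^ 6 - c 5 * s ^ 5 + c 4 * s ^ 4 - c 3 * s ^ 3 + c 2 * s ^ 2 - c 1 * s + c 0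

theorem isPositiveCSPolynomial_iff {f : ℤ[X]} (hf : f.Monic) (hdeg : f.natDegree = 6)
    (hcs : IsCSPolynomial 6 f) :
    IsPositiveCSPolynomial 6 f ↔ PosOnNeg fun i => f.coeff i := by
  have heval : ∀ t : ℝ, (-1 : ℝ) ^ 6 * aeval t f = t ^ 6 + f.coeff 5 * t ^ 5 + f.coeff 4 * t ^ 4
      + f.coeff 3 * t ^ 3 + f.coeff 2 * t ^ 2 + f.coeff 1 * t + f.coeff 0 := fun t => by
    have h6 : f.coeff 6 = 1 := by rw [← hdeg]; exact hf.coeff_natDegree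
    rw [aeval_eq_sum_range, hdeg]
    simp [Finset.sum_range_succ, h6]
    ring
  simp only [IsPositiveCSPolynomial, hcs, true_and, heval, PosOnNeg]
  constructor
  · intro h s hs
    convert h (-s) (by linarith) using 1
    simp
    ring
  · intro h t ht
    convert h (-t) (by linarith) using 1
    simp
    ring

/-- The inequality at `s = m / n`, without denominators. -/
theorem PosOnNeg.homogeneous {c : Fin 6 → ℤ} (h : PosOnNeg c) {m n : ℝ} (hm : 0 < m) (hn : 0 < n) :
    0 < m ^ 6 - c 5 * m ^ 5 * n + c 4 * m ^ 4 * n ^ 2 - c 3 * m ^ 3 * n ^ 3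
      + c 2 * m ^ 2 * n ^ 4 - c 1 * m * n ^ 5 + c 0 * n ^ 6 := by
  have := mul_pos (pow_pos hn 6) (h (m / n) (div_pos hm hn))
  refine this.trans_eq ?_
  field_simp

theorem posOnNeg_of_alternating {c : Fin 6 → ℤ} (h : c 0 = 1 ∧ c 1 ≤ 0 ∧ 0 ≤ c 2 ∧ c 3 ≤ 0 ∧
    0 ≤ c 4 ∧ c 5 ≤ 0) : PosOnNeg c := by
  obtain ⟨h0, h1, h2, h3, h4, h5⟩ := h
  intro s hs
  have e1 : (0 : ℝ) ≤ -(c 1 : ℝ) := by exact_mod_cast neg_nonneg.2 h1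
  have e2 : (0 : ℝ) ≤ (c 2 : ℝ) := by exact_mod_cast h2
  have e3 : (0 : ℝ) ≤ -(c 3 : ℝ) := by exact_mod_cast neg_nonneg.2 h3
  have e4 : (0 : ℝ) ≤ (c 4 : ℝ) := by exact_mod_cast h4
  have e5 : (0 : ℝ) ≤ -(c 5 : ℝ) := by exact_mod_cast neg_nonneg.2 h5
  rw [h0]
  simp only [sub_eq_add_neg, ← neg_mul]
  positivity

theorem not_posOnNeg_of_witness {c : Fin 6 → ℤ} (x : List (ℤ × ℤ))
    (h : ∃ y ∈ x, 0 < y.1 ∧ 0 < y.2 ∧ y.1 ^ 6 - c 5 * y.1 ^ 5 * y.2 + c 4 * y.1 ^ 4 * y.2 ^ 2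
      - c 3 * y.1 ^ 3 * y.2 ^ 3 + c 2 * y.1 ^ 2 * y.2 ^ 4 - c 1 * y.1 * y.2 ^ 5
      + c 0 * y.2 ^ 6 ≤ 0) : ¬ PosOnNeg c := by
  obtain ⟨⟨m, n⟩, -, hm, hn, hle⟩ := h
  intro hc
  have := hc.homogeneous (m := m) (n := n) (by exact_mod_cast hm) (by exact_mod_cast hn)
  exact absurd hle (not_le.2 (by exact_mod_cast this))

theorem pow_pos_upto_six {s : ℝ} (hs : 0 < s) :
    0 < s ^ 2 ∧ 0 < s ^ 3 ∧ 0 < s ^ 4 ∧ 0 < s ^ 5 ∧ 0 < s ^ 6 := by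
  refine ⟨?_, ?_, ?_, ?_, ?_⟩ <;> positivity

/-- Building blocks for certificates of positivity: a sextic that is positive for `s > 0` is often a
nonnegative combination of these terms, with `r` close to its minima, and of powers of `s`. -/
theorem mul_sq_sub_nonneg {s : ℝ} (hs : 0 < s) (r : ℝ) : 0 ≤ (s - r) ^ 2 ∧ 0 ≤ s * (s - r) ^ 2 ∧
    0 ≤ s ^ 2 * (s - r) ^ 2 ∧ 0 ≤ s ^ 3 * (s - r) ^ 2 ∧ 0 ≤ s ^ 4 * (s - r) ^ 2 := by
  refine ⟨?_, ?_, ?_, ?_, ?_⟩ <;> positivity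

theorem posOnNeg_table_0_iff (a : ℤ) :
    PosOnNeg ![1, 2 * a + 1, a ^ 2 - a, -2 * a ^ 2 - 2 * a - 2, a ^ 2 - a - 1, 2 * a + 1] ↔
      a ≤ 0 := by
  constructor
  · intro h
    by_contra ha
    obtain ⟨b, rfl⟩ : ∃ b : ℕ, a = b + 1 := ⟨(a - 1).toNat, by omega⟩
    refine absurd (h.homogeneous (m := b + 2) (n := 1)
      (by positivity) (by norm_num))
      (not_lt.2 ?_)
    simp
    rw [← sub_nonneg]
    ring_nf
    positivity
  · intro ha
    obtain ha | rfl : a ≤ -1 ∨ a = 0 := by omega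
    · obtain ⟨b, rfl⟩ : ∃ b : ℕ, a = -1 - b := ⟨(-1 - a).toNat, by omega⟩
      intro s hs
      simp
      ring_nf
      positivity
    · intro s hs
      obtain ⟨_, _, _, _, _⟩ := mul_sq_sub_nonneg hs (1 / 2)
      obtain ⟨_, _, _, _, _⟩ := mul_sq_sub_nonneg hs 1
      obtain ⟨_, _, _, _, _⟩ := pow_pos_upto_six hs
      simp
      linarith

theorem posOnNeg_table_1_iff (a : ℤ) :
    PosOnNeg ![1, 2 * a + 1, a ^ 2 - a - 1, -2 * a ^ 2 - 2 * a - 2, a ^ 2 - a - 2, 2 * a + 1] ↔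
      a ≤ -1 := by
  constructor
  · intro h
    by_contra ha
    obtain ⟨b, rfl⟩ : ∃ b : ℕ, a = b := ⟨a.toNat, by omega⟩
    refine absurd (h.homogeneous (m := b + 1) (n := 1)
      (by positivity) (by norm_num))
      (not_lt.2 ?_)
    simp
    rw [← sub_nonneg]
    ring_nf
    positivity
  · intro ha
    obtain ⟨b, rfl⟩ : ∃ b : ℕ, a = -1 - b := ⟨(-1 - a).toNat, by omega⟩
    intro s hs
    simp
    ring_nf
    positivity

theorem posOnNeg_table_2_iff (a : ℤ) :
    PosOnNeg ![1, 2 * a + 1, a ^ 2 - a - 1, -2 * a ^ 2 - 2 * a - 2, a ^ 2 - a, 2 * a + 1] ↔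
      a ≤ 0 := by
  constructor
  · intro h
    by_contra ha
    obtain ⟨b, rfl⟩ : ∃ b : ℕ, a = b + 1 := ⟨(a - 1).toNat, by omega⟩
    refine absurd (h.homogeneous (m := 1) (n := b + 2)
      (by norm_num) (by positivity))
      (not_lt.2 ?_)
    simp
    rw [← sub_nonneg]
    ring_nf
    positivity
  · intro ha
    obtain ha | rfl : a ≤ -1 ∨ a = 0 := by omega
    · obtain ⟨b, rfl⟩ : ∃ b : ℕ, a = -1 - b := ⟨(-1 - a).toNat, by omega⟩
      intro s hs
      simp
      ring_nf
      positivity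
    · intro s hs
      obtain ⟨_, _, _, _, _⟩ := mul_sq_sub_nonneg hs (2 / 3)
      obtain ⟨_, _, _, _, _⟩ := mul_sq_sub_nonneg hs 1
      obtain ⟨_, _, _, _, _⟩ := pow_pos_upto_six hs
      simp
      linarith

theorem posOnNeg_table_3_iff (a : ℤ) :
    PosOnNeg ![1, 2 * a + 1, a ^ 2 - a - 2, -2 * a ^ 2 - 2 * a - 2, a ^ 2 - a - 1, 2 * a + 1] ↔
      a ≤ -1 := by
  constructor
  · intro h
    by_contra ha
    obtain ⟨b, rfl⟩ : ∃ b : ℕ, a = b := ⟨a.toNat, by omega⟩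
    refine absurd (h.homogeneous (m := b + 1) (n := 1)
      (by positivity) (by norm_num))
      (not_lt.2 ?_)
    simp
    rw [← sub_nonneg]
    ring_nf
    positivity
  · intro ha
    obtain ⟨b, rfl⟩ : ∃ b : ℕ, a = -1 - b := ⟨(-1 - a).toNat, by omega⟩
    intro s hs
    simp
    ring_nf
    positivity

/-- As a quadratic polynomial in `a`, the value `f(-s)` has negative discriminant for every `s > 0`. -/
theorem posOnNeg_table_4 (a : ℤ) :
    PosOnNeg ![1, 3 * a - 1, 3 * a ^ 2 - a + 4, -6 * a ^ 2 - 4 * a - 6, 3 * a ^ 2 - a + 2, 3 * a] := by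
  intro s hs
  refine pos_of_mul_pos_right (a := 12 * s ^ 2 * (s + 1) ^ 2) ?_ (by positivity)
  have : (0 : ℝ) < (6 * s ^ 2 * (s + 1) ^ 2 * a - (3 * s ^ 5 + s ^ 4 - 4 * s ^ 3 + s ^ 2 + 3 * s)) ^ 2 +
      (3 * s ^ 10 + 18 * s ^ 9 + 59 * s ^ 8 + 122 * s ^ 7 + 180 * s ^ 6 + 182 * s ^ 5
        + 107 * s ^ 4 + 30 * s ^ 3 + 3 * s ^ 2) := by positivity
  refine this.trans_eq ?_
  simp
  ring

/-- The discriminant in `a` is negative for every `s > 0`, as in the preceding row. -/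
theorem posOnNeg_table_5 (a : ℤ) :
    PosOnNeg ![1, 3 * a, 3 * a ^ 2 + a + 4, -6 * a ^ 2 - 8 * a - 8, 3 * a ^ 2 + a + 2, 3 * a + 1] := by
  intro s hs
  refine pos_of_mul_pos_right (a := 12 * s ^ 2 * (s + 1) ^ 2) ?_ (by positivity)
  have : (0 : ℝ) < (6 * s ^ 2 * (s + 1) ^ 2 * a - (3 * s ^ 5 - s ^ 4 - 8 * s ^ 3 - s ^ 2 + 3 * s)) ^ 2 +
      (3 * s ^ 10 + 18 * s ^ 9 + 59 * s ^ 8 + 122 * s ^ 7 + 180 * s ^ 6 + 182 * s ^ 5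
        + 107 * s ^ 4 + 30 * s ^ 3 + 3 * s ^ 2) := by positivity
  refine this.trans_eq ?_
  simp
  ring

theorem posOnNeg_table_6_iff (a : ℤ) :
    PosOnNeg ![1, 2 * a - 1, a ^ 2 - 3 * a, -2 * a ^ 2 + a - 1, a ^ 2 - 2 * a + 1, 2 * a] ↔
      a ≤ 0 := by
  constructor
  · intro h
    by_contra ha
    obtain ⟨b, rfl⟩ : ∃ b : ℕ, a = b + 1 := ⟨(a - 1).toNat, by omega⟩
    refine absurd (h.homogeneous (m := 2) (n := 2 * b + 3)
      (by norm_num) (by positivity))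
      (not_lt.2 ?_)
    simp
    rw [← sub_nonneg]
    ring_nf
    positivity
  · intro ha
    obtain ⟨b, rfl⟩ : ∃ b : ℕ, a = -b := ⟨(-a).toNat, by omega⟩
    intro s hs
    simp
    ring_nf
    positivity

theorem posOnNeg_table_7_iff (a : ℤ) :
    PosOnNeg ![1, 2 * a, a ^ 2 - 2 * a - 1, -2 * a ^ 2 - a - 1, a ^ 2 - a, 2 * a + 1] ↔
      a ≤ 0 := by
  constructor
  · intro h
    by_contra ha
    obtain ⟨b, rfl⟩ : ∃ b : ℕ, a = b + 1 := ⟨(a - 1).toNat, by omega⟩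
    refine absurd (h.homogeneous (m := b + 2) (n := 1)
      (by positivity) (by norm_num))
      (not_lt.2 ?_)
    simp
    rw [← sub_nonneg]
    ring_nf
    positivity
  · intro ha
    obtain ha | rfl : a ≤ -1 ∨ a = 0 := by omega
    · obtain ⟨b, rfl⟩ : ∃ b : ℕ, a = -1 - b := ⟨(-1 - a).toNat, by omega⟩
      intro s hs
      simp
      ring_nf
      positivity
    · intro s hs
      obtain ⟨_, _, _, _, _⟩ := mul_sq_sub_nonneg hs (3 / 4)
      obtain ⟨_, _, _, _, _⟩ := pow_pos_upto_six hs
      simp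
      linarith

theorem posOnNeg_table_12_iff (a : ℤ) :
    PosOnNeg ![1, 5 * a - 2, 5 * a ^ 2 - 11 * a + 2, -10 * a ^ 2 + 12 * a - 2, 5 * a ^ 2 - 11 * a, 5 * a - 1] ↔
      a ≤ 0 := by
  constructor
  · intro h
    by_contra ha
    obtain ⟨b, rfl⟩ : ∃ b : ℕ, a = b + 1 := ⟨(a - 1).toNat, by omega⟩
    refine absurd (h.homogeneous (m := 2 * b + 1) (n := 1)
      (by positivity) (by norm_num))
      (not_lt.2 ?_)
    simp
    rw [← sub_nonneg]
    ring_nf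
    positivity
  · intro ha
    obtain ⟨b, rfl⟩ : ∃ b : ℕ, a = -b := ⟨(-a).toNat, by omega⟩
    intro s hs
    simp
    ring_nf
    positivity

theorem posOnNeg_table_13_iff (a : ℤ) :
    PosOnNeg ![1, 5 * a - 1, 5 * a ^ 2 - 9 * a, -10 * a ^ 2 + 8 * a, 5 * a ^ 2 - 9 * a - 2, 5 * a] ↔
      a ≤ 0 := by
  constructor
  · intro h
    by_contra ha
    obtain ⟨b, rfl⟩ : ∃ b : ℕ, a = b + 1 := ⟨(a - 1).toNat, by omega⟩
    refine absurd (h.homogeneous (m := 2 * b + 1) (n := 1)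
      (by positivity) (by norm_num))
      (not_lt.2 ?_)
    simp
    rw [← sub_nonneg]
    ring_nf
    positivity
  · intro ha
    obtain ha | rfl : a ≤ -1 ∨ a = 0 := by omega
    · obtain ⟨b, rfl⟩ : ∃ b : ℕ, a = -1 - b := ⟨(-1 - a).toNat, by omega⟩
      intro s hs
      simp
      ring_nf
      positivity
    · intro s hs
      obtain ⟨_, _, _, _, _⟩ := mul_sq_sub_nonneg hs (11 / 10)
      obtain ⟨_, _, _, _, _⟩ := mul_sq_sub_nonneg hs 1
      obtain ⟨_, _, _, _, _⟩ := pow_pos_upto_six hs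
      simp
      linarith

theorem posOnNeg_table_14_iff (a : ℤ) :
    PosOnNeg ![1, 5 * a, 5 * a ^ 2 - 7 * a - 2, -10 * a ^ 2 + 4 * a + 2, 5 * a ^ 2 - 7 * a - 4, 5 * a + 1] ↔
      a ≤ -1 := by
  constructor
  · intro h
    by_contra ha
    obtain ⟨b, rfl⟩ : ∃ b : ℕ, a = b := ⟨a.toNat, by omega⟩
    refine absurd (h.homogeneous (m := 2 * b + 1) (n := 1)
      (by positivity) (by norm_num))
      (not_lt.2 ?_)
    simp
    rw [← sub_nonneg]
    ring_nf
    positivity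
  · intro ha
    obtain ⟨b, rfl⟩ : ∃ b : ℕ, a = -1 - b := ⟨(-1 - a).toNat, by omega⟩
    intro s hs
    simp
    ring_nf
    positivity

theorem posOnNeg_table_15_iff (a : ℤ) :
    PosOnNeg ![1, 5 * a + 2, 5 * a ^ 2 - 3 * a - 4, -10 * a ^ 2 - 4 * a + 2, 5 * a ^ 2 - 3 * a - 6, 5 * a + 3] ↔
      a ≤ -1 := by
  constructor
  · intro h
    by_contra ha
    obtain ⟨b, rfl⟩ : ∃ b : ℕ, a = b := ⟨a.toNat, by omega⟩
    refine absurd (h.homogeneous (m := 2 * b + 1) (n := 1)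
      (by positivity) (by norm_num))
      (not_lt.2 ?_)
    simp
    rw [← sub_nonneg]
    ring_nf
    positivity
  · intro ha
    obtain ⟨b, rfl⟩ : ∃ b : ℕ, a = -1 - b := ⟨(-1 - a).toNat, by omega⟩
    intro s hs
    simp
    ring_nf
    positivity

theorem posOnNeg_table_16_iff (a : ℤ) :
    PosOnNeg ![1, 2 * a - 1, a ^ 2 - 3 * a, -2 * a ^ 2 + a - 2, a ^ 2 - 2 * a, 2 * a] ↔
      a ≤ 0 := by
  constructor
  · intro h
    by_contra ha
    obtain ⟨b, rfl⟩ : ∃ b : ℕ, a = b + 1 := ⟨(a - 1).toNat, by omega⟩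
    refine absurd (h.homogeneous (m := b + 1) (n := 1)
      (by positivity) (by norm_num))
      (not_lt.2 ?_)
    simp
    rw [← sub_nonneg]
    ring_nf
    positivity
  · intro ha
    obtain ⟨b, rfl⟩ : ∃ b : ℕ, a = -b := ⟨(-a).toNat, by omega⟩
    intro s hs
    simp
    ring_nf
    positivity

theorem posOnNeg_table_17_iff (a : ℤ) :
    PosOnNeg ![1, 2 * a, a ^ 2 - 2 * a - 1, -2 * a ^ 2 - a - 3, a ^ 2 - a, 2 * a + 1] ↔
      a ≤ 2 := by
  constructor
  · intro h
    by_contra ha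
    obtain rfl | rfl | ha : a = 3 ∨ a = 4 ∨ 5 ≤ a := by omega
    · exact not_posOnNeg_of_witness [(21, 5)] (by decide) h
    · exact not_posOnNeg_of_witness [(21, 4)] (by decide) h
    obtain ⟨b, rfl⟩ : ∃ b : ℕ, a = b + 5 := ⟨(a - 5).toNat, by omega⟩
    refine absurd (h.homogeneous (m := 2 * b + 13) (n := 2)
      (by positivity) (by norm_num))
      (not_lt.2 ?_)
    simp
    rw [← sub_nonneg]
    ring_nf
    positivity
  · intro ha
    obtain ha | rfl | rfl | rfl : a ≤ -1 ∨ a = 0 ∨ a = 1 ∨ a = 2 := by omega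
    · obtain ⟨b, rfl⟩ : ∃ b : ℕ, a = -1 - b := ⟨(-1 - a).toNat, by omega⟩
      intro s hs
      simp
      ring_nf
      positivity
    · intro s hs
      obtain ⟨_, _, _, _, _⟩ := mul_sq_sub_nonneg hs (1 / 4)
      obtain ⟨_, _, _, _, _⟩ := mul_sq_sub_nonneg hs 1
      obtain ⟨_, _, _, _, _⟩ := pow_pos_upto_six hs
      simp
      linarith
    · intro s hs
      obtain ⟨_, _, _, _, _⟩ := mul_sq_sub_nonneg hs (21 / 40)
      obtain ⟨_, _, _, _, _⟩ := mul_sq_sub_nonneg hs 1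
      obtain ⟨_, _, _, _, _⟩ := pow_pos_upto_six hs
      simp
      nlinarith
    · intro s hs
      obtain ⟨_, _, _, _, _⟩ := mul_sq_sub_nonneg hs (7 / 20)
      obtain ⟨_, _, _, _, _⟩ := mul_sq_sub_nonneg hs 3
      obtain ⟨_, _, _, _, _⟩ := pow_pos_upto_six hs
      simp
      nlinarith

/-- As a quadratic polynomial in `a`, the value `f(-s)` has discriminant `s⁴(s + 1)²(1 - 4s)`, which is
negative for `s > 1 / 4`. -/
theorem posOnNeg_table_18_of_le_three {a : ℤ} (h1 : 1 ≤ a) (h3 : a ≤ 3) :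
    PosOnNeg ![1, 2 * a - 1, a ^ 2 - 3 * a, -2 * a ^ 2 + a - 3, a ^ 2 - 2 * a + 1, 2 * a] := by
  intro s hs
  rcases lt_or_ge (1 / 4) s with hs4 | hs4
  · refine pos_of_mul_pos_right (a := 4 * s ^ 2 * (s + 1) ^ 2) ?_ (by positivity)
    have : (0 : ℝ) < (2 * s ^ 2 * (s + 1) ^ 2 * a - (2 * s ^ 5 + 2 * s ^ 4 + s ^ 3 + 3 * s ^ 2 + 2 * s)) ^ 2
        + s ^ 4 * (s + 1) ^ 2 * (4 * s - 1) := by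
      have : 0 < 4 * s - 1 := by linarith
      positivity
    refine this.trans_eq ?_
    simp
    ring
  · have e2 : s ^ 2 ≤ s * (1 / 4) := by nlinarith
    have e5 : s ^ 5 ≤ s ^ 4 * (1 / 4) := by nlinarith [pow_pos hs 4]
    have p3 := pow_pos hs 3
    have p4 := pow_pos hs 4
    have p6 := pow_pos hs 6
    obtain rfl | rfl | rfl : a = 1 ∨ a = 2 ∨ a = 3 := by omega
    · simp
      nlinarith
    · simp
      nlinarith
    · simp
      nlinarith [mul_nonneg hs.le (sq_nonneg (s - 1 / 4))]

theorem posOnNeg_table_18_iff (a : ℤ) :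
    PosOnNeg ![1, 2 * a - 1, a ^ 2 - 3 * a, -2 * a ^ 2 + a - 3, a ^ 2 - 2 * a + 1, 2 * a] ↔
      a ≤ 3 := by
  constructor
  · intro h
    by_contra ha
    obtain ⟨b, rfl⟩ : ∃ b : ℕ, a = b + 4 := ⟨(a - 4).toNat, by omega⟩
    refine absurd (h.homogeneous (m := 2) (n := 2 * b + 9)
      (by norm_num) (by positivity))
      (not_lt.2 ?_)
    simp
    rw [← sub_nonneg]
    ring_nf
    positivity
  · intro ha
    obtain ha | rfl | rfl | rfl : a ≤ 0 ∨ a = 1 ∨ a = 2 ∨ a = 3 := by omega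
    · obtain ⟨b, rfl⟩ : ∃ b : ℕ, a = -b := ⟨(-a).toNat, by omega⟩
      intro s hs
      simp
      ring_nf
      positivity
    · exact posOnNeg_table_18_of_le_three (by norm_num) (by norm_num)
    · exact posOnNeg_table_18_of_le_three (by norm_num) (by norm_num)
    · exact posOnNeg_table_18_of_le_three (by norm_num) (by norm_num)

theorem posOnNeg_table_19_iff (a : ℤ) :
    PosOnNeg ![1, 2 * a, a ^ 2 - 2 * a - 2, -2 * a ^ 2 - a - 2, a ^ 2 - a, 2 * a + 1] ↔
      a ≤ 0 := by
  constructor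
  · intro h
    by_contra ha
    obtain ⟨b, rfl⟩ : ∃ b : ℕ, a = b + 1 := ⟨(a - 1).toNat, by omega⟩
    refine absurd (h.homogeneous (m := b + 2) (n := 1)
      (by positivity) (by norm_num))
      (not_lt.2 ?_)
    simp
    rw [← sub_nonneg]
    ring_nf
    positivity
  · intro ha
    obtain ha | rfl : a ≤ -1 ∨ a = 0 := by omega
    · obtain ⟨b, rfl⟩ : ∃ b : ℕ, a = -1 - b := ⟨(-1 - a).toNat, by omega⟩
      intro s hs
      simp
      ring_nf
      positivity
    · intro s hs
      obtain ⟨_, _, _, _, _⟩ := mul_sq_sub_nonneg hs (7 / 10)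
      obtain ⟨_, _, _, _, _⟩ := mul_sq_sub_nonneg hs 1
      obtain ⟨_, _, _, _, _⟩ := pow_pos_upto_six hs
      simp
      linarith

theorem posOnNeg_table_50 : PosOnNeg ![1, -1, -3, -2, 2, 3] := by
  intro s hs
  obtain ⟨_, _, _, _, _⟩ := mul_sq_sub_nonneg hs 1
  obtain ⟨_, _, _, _, _⟩ := pow_pos_upto_six hs
  simp
  nlinarith

theorem posOnNeg_table_35 : PosOnNeg ![1, -1, -2, -2, 1, 1] := by
  intro s hs
  obtain ⟨_, _, _, _, _⟩ := mul_sq_sub_nonneg hs 1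
  obtain ⟨_, _, _, _, _⟩ := pow_pos_upto_six hs
  simp
  linarith

theorem posOnNeg_iff_of_mem_table : ∀ r ∈ table, ∀ a, PosOnNeg (r.coeffs a) ↔ r.pos a := by
  simp only [table, List.forall_mem_cons]
  and_intros
  on_goal 94 => simp
  all_goals first
    | exact fun _ => iff_of_true (posOnNeg_of_alternating (by decide)) trivial
    | exact fun _ => iff_of_false (not_posOnNeg_of_witness
        [(1, 1), (2, 1), (3, 1), (6, 1), (9, 1), (11, 1), (19, 1), (1, 3)] (by decide)) id
    | exact fun _ => iff_of_true posOnNeg_table_35 trivial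
    | exact fun _ => iff_of_true posOnNeg_table_50 trivial
    | exact posOnNeg_table_0_iff
    | exact posOnNeg_table_1_iff
    | exact posOnNeg_table_2_iff
    | exact posOnNeg_table_3_iff
    | exact fun a => iff_of_true (posOnNeg_table_4 a) trivial
    | exact fun a => iff_of_true (posOnNeg_table_5 a) trivial
    | exact posOnNeg_table_6_iff
    | exact posOnNeg_table_7_iff
    | exact posOnNeg_table_12_iff
    | exact posOnNeg_table_13_iff
    | exact posOnNeg_table_14_iff
    | exact posOnNeg_table_15_iff
    | exact posOnNeg_table_16_iff
    | exact posOnNeg_table_17_iff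
    | exact posOnNeg_table_18_iff
    | exact posOnNeg_table_19_iff

end CappellShaneson

theorem proposition6p1 (f : Polynomial ℤ) (hmonic : f.Monic) (hdeg : f.natDegree = 6)
    (hq0 : 0 ≤ f.coeff 5 - f.coeff 1) (hq12 : f.coeff 5 - f.coeff 1 ≤ 12) :
    (CappellShaneson.IsCSPolynomial 6 f ↔
      ∃ r ∈ CappellShaneson.table, ∃ a : ℤ, (fun i : Fin 6 => f.coeff i) = r.coeffs a) ∧
    (∀ r ∈ CappellShaneson.table, ∀ a : ℤ, (fun i : Fin 6 => f.coeff i) = r.coeffs a →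
      (CappellShaneson.IsPositiveCSPolynomial 6 f ↔ r.pos a)) := by
  have hiff := CappellShaneson.isCSPolynomial_iff hmonic hdeg
  have hmem : ∀ r ∈ CappellShaneson.table, ∀ a : ℤ, (fun i : Fin 6 => f.coeff i) = r.coeffs a →
      CappellShaneson.IsCSPolynomial 6 f := fun r hr a h =>
    hiff.2 (h ▸ CappellShaneson.isCSTuple_of_mem_table r hr a)
  refine ⟨⟨fun h => ?_, fun ⟨r, hr, a, h⟩ => hmem r hr a h⟩, fun r hr a h => ?_⟩
  · exact CappellShaneson.exists_mem_table_of_isCSTuple (hiff.1 h) hq0 hq12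
  · rw [CappellShaneson.isPositiveCSPolynomial_iff hmonic hdeg (hmem r hr a h), h]
    exact CappellShaneson.posOnNeg_iff_of_mem_table r hr a
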